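/- Let $Q$ be a tree network: a connected network without circuits made of finitely many (at least one) arcs of positive length, viewed as a metric space in which $d(x,y)$ is the length of the path $P(x,y)$ from $x$ to $y$ (points in the interior of arcs included), with length measure $\lambda$ and total length $\mu=\lambda(Q)$. Let $u=\lambda/\mu$ be the uniform distribution on $Q$ and, for $x\in Q$, let $\bar d(x)=\int_Q d(x,y)\,du(y)$ be the mean distance from $x$. A search from a root $O\in Q$ is a map $S:[0,\infty)\to Q$ with $S(0)=O$ and $d(S(t_1),S(t_2))\le t_2-t_1$ for all $0\le t_1\le t_2$. Let $T(S,x)=\min\{t\ge 0: S(t)=x\}$ (or $+\infty$ if $x$ is never reached), let $T(S,u)=\int_Q T(S,x)\,du(x)$, and let $V(u)=V_O(u)$ be the infimum of $T(S,u)$ over all searches $S$ from $O$; a search that attains it is called optimal. The nodes of the tree with root $O$ are $O$ and all points of degree different from $2$, where the degree of $x$ is the number of connected components of $Q\setminus\{x\}$; leaf nodes are the points of degree $1$; arcs are the paths joining two distinct nodes with no further node on them. A search from $O$ is depth-first (DF) if it follows, at unit speed, a sequence of arcs that starts and ends at $O$ and traverses every arc exactly once in each direction, such that, when leaving a node, the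 unique arc towards $O$ is chosen only if all other arcs at that node have been traversed. The behaviour of a search after it has covered $Q$ is disregarded. Then the following hold. (i) For every root $O\in Q$, the distribution $u$ is strongly simply searchable, that is, an optimal search from $O$ exists and every optimal search from $O$ coincides with a DF search from $O$ until $Q$ has been covered. Moreover, $$V_O(u)=\mu-\bar d(O)<\infty .$$ (ii) The roots that minimize the expected search time of DF searches are exactly the leaf nodes with the largest mean distance, and such a leaf node exists. That is, some leaf node maximizes $\bar d$ among all leaf nodes; and a point $x\in Q$ satisfies $T(S,u)\le T(S',u)$ for all $y\in Q$, all DF searches $S$ from $x$ and all DF searches $S'$ from $y$ if and only if $x$ is a leaf node and $\bar d(y)\le\bar d(x)$ for every leaf node $y$. -/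

import Mathlib

open MeasureTheory Set
open scoped NNReal ENNReal

noncomputable section

namespace TreeSearch

/-- The shortest path `P(x, y)`: all points lying between `x` and `y`. -/
def path {Q : Type*} [MetricSpace Q] (x y : Q) : Set Q :=
  {z | dist x z + dist z y = dist x y}

/-- A tree network, as a continuous metric space: the distance is the length of a shortest path,
there are no circuits, and the space is made up of finitely many arcs. -/
structure IsTreeNetwork (Q : Type*) [MetricSpace Q] : Prop where
  /-- Any two points are joined by a path whose length is their distance. -/
  geodesic : ∀ x y : Q, ∃ γ : ℝ → Q, γ 0 = x ∧ γ (dist x y) = y ∧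
    ∀ s ∈ Icc 0 (dist x y), ∀ t ∈ Icc 0 (dist x y), dist (γ s) (γ t) = |s - t|
  /-- No circuits: two points are joined by only one injective path, up to parametrization. -/
  uniqueArc : ∀ (x y : Q) (p q : Path x y),
    Function.Injective p → Function.Injective q → range p = range q
  /-- Finitely many arcs. -/
  finiteArcs : ∃ F : Set Q, F.Finite ∧ ∀ z : Q, ∃ a ∈ F, ∃ b ∈ F, z ∈ path a b

/-- The degree of a point: the number of components left when the point is removed. -/
def degree {Q : Type*} [MetricSpace Q] (x : Q) : ℕ :=
  Nat.card (ConnectedComponents ({x}ᶜ : Set Q))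

/-- Leaf nodes are the points of degree one. -/
def IsLeaf {Q : Type*} [MetricSpace Q] (x : Q) : Prop := degree x = 1

/-- The nodes of the tree rooted at `O`: the root, the leaf nodes and the points of degree at
least three. (Further nodes of degree two would not change which searches are depth-first.) -/
def IsNode {Q : Type*} [MetricSpace Q] (O x : Q) : Prop := x = O ∨ degree x ≠ 2

/-- There is an arc with end nodes `a` and `b`, namely `path a b`. -/
def IsArc {Q : Type*} [MetricSpace Q] (O a b : Q) : Prop :=
  IsNode O a ∧ IsNode O b ∧ a ≠ b ∧ ∀ z ∈ path a b, IsNode O z → z = a ∨ z = b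

/-- The length measure: one-dimensional Hausdorff measure, which is Lebesgue measure
on every arc. -/
def lengthMeasure (Q : Type*) [MetricSpace Q] [MeasurableSpace Q] [BorelSpace Q] : Measure Q :=
  Measure.hausdorffMeasure 1

/-- The total length of the network. -/
def totalLength (Q : Type*) [MetricSpace Q] [MeasurableSpace Q] [BorelSpace Q] : ℝ :=
  (lengthMeasure Q univ).toReal

/-- The uniform distribution `A ↦ λ(A) / λ(Q)`. -/
def uniform (Q : Type*) [MetricSpace Q] [MeasurableSpace Q] [BorelSpace Q] : Measure Q :=
  (lengthMeasure Q univ)⁻¹ • lengthMeasure Q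

/-- The mean distance from `x` to a point of the network, with respect to `h`. -/
def meanDist {Q : Type*} [MetricSpace Q] [MeasurableSpace Q] (h : Measure Q) (x : Q) : ℝ :=
  ∫ y, dist x y ∂h

/-- A search of the network from the root `O`: a path of speed at most one that starts at `O`. -/
structure Search {Q : Type*} [MetricSpace Q] (O : Q) where
  toFun : ℝ≥0 → Q
  start : toFun 0 = O
  dist_le : ∀ s t : ℝ≥0, s ≤ t → dist (toFun s) (toFun t) ≤ (t : ℝ) - (s : ℝ)

/-- The search time `T(S, x)`: the first time at which `S` is at `x`, infinite if there is none. -/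
def searchTime {Q : Type*} [MetricSpace Q] {O : Q} (S : Search O) (x : Q) : ℝ≥0∞ :=
  ⨅ (t : ℝ≥0) (_ : S.toFun t = x), (t : ℝ≥0∞)

/-- The expected search time `T(S, h)`. -/
def expectedTime {Q : Type*} [MetricSpace Q] [MeasurableSpace Q] {O : Q}
    (S : Search O) (h : Measure Q) : ℝ≥0∞ :=
  ∫⁻ x, searchTime S x ∂h

/-- `S` is optimal against `h`: no search from the same root has a smaller expected time. -/
def IsOptimal {Q : Type*} [MetricSpace Q] [MeasurableSpace Q] {O : Q}
    (S : Search O) (h : Measure Q) : Prop :=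
  ∀ S' : Search O, expectedTime S h ≤ expectedTime S' h

/-- `V(h)`: the least expected search time from the root `O` against `h`. -/
def value {Q : Type*} [MetricSpace Q] [MeasurableSpace Q] (O : Q) (h : Measure Q) : ℝ≥0∞ :=
  ⨅ S : Search O, expectedTime S h

/-- The time needed at unit speed for the first `i` steps of a sequence of nodes. -/
def arrivalTime {Q : Type*} [MetricSpace Q] (v : ℕ → Q) (i : ℕ) : ℝ :=
  ∑ j ∈ Finset.range i, dist (v j) (v (j + 1))

/-- Depth-first search: `S` follows, at unit speed, a sequence of arcs that starts and ends at the
root and traverses every arc once in each direction, such that the arc towards the root is chosen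
when leaving a node only if all the other arcs at that node have been traversed. -/
def IsDF {Q : Type*} [MetricSpace Q] {O : Q} (S : Search O) : Prop :=
  ∃ (n : ℕ) (v : ℕ → Q),
    v 0 = O ∧ v n = O ∧
    (∀ i < n, IsArc O (v i) (v (i + 1))) ∧
    (∀ a b : Q, IsArc O a b → ∃! i : ℕ, i < n ∧ v i = a ∧ v (i + 1) = b) ∧
    (∀ i < n, v (i + 1) ∈ path O (v i) →
      ∀ w : Q, IsArc O (v i) w → w ≠ v (i + 1) → ∃ j < i, v j = v i ∧ v (j + 1) = w) ∧
    (∀ i < n, ∀ t : ℝ≥0, arrivalTime v i ≤ (t : ℝ) → (t : ℝ) ≤ arrivalTime v (i + 1) →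
      S.toFun t ∈ path (v i) (v (i + 1)) ∧ dist (v i) (S.toFun t) = (t : ℝ) - arrivalTime v i)

/-- `S` is depth-first, disregarding its behaviour after the whole network has been covered. -/
def IsDFUntilCovered {Q : Type*} [MetricSpace Q] {O : Q} (S : Search O) : Prop :=
  ∃ S' : Search O, IsDF S' ∧ ∀ t : ℝ≥0, S.toFun '' Icc 0 t ≠ univ → S.toFun t = S'.toFun t

/-- Optimal searches against `h` exist, and they are all depth-first. -/
def StronglySimplySearchable {Q : Type*} [MetricSpace Q] [MeasurableSpace Q]
    (O : Q) (h : Measure Q) : Prop :=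
  (∃ S : Search O, IsOptimal S h) ∧ ∀ S : Search O, IsOptimal S h → IsDFUntilCovered S

end TreeSearch

end

open TreeSearch

/-!
A search that has reached `x` at time `t` has walked twice over almost every point it has covered,
except for those on the path from the root `O` to `x`. So if `A` is the part covered by then,
`2 λ(A) ≤ t + d(O, x)`. This holds for every curve of speed at most one
(`IsTreeNetwork.two_mul_length_image_le`) and is proved for finitely many points of the curve by
adding them one at a time; a connected subset of a tree is the hull of finitely many points.

On average over `x`, the part covered when `x` is found has at least half of the total length `μ`,
because of any two points one is found no later than the other. Integrating therefore gives
`μ - d̄(O)` as a lower bound for the expected search time (`IsTreeNetwork.totalLength_le`).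
A *tour*, that is, a closed covering curve, of duration at most `2 μ` attains it
(`IsTreeNetwork.expectedTime_of_tour`): both the part before and the part after the visit to
`x` satisfy the inequality, and adding the two leaves no slack. Such tours exist, by inserting
detours (`IsTreeNetwork.exists_isTour`). Conversely, a search that attains the bound has equality for almost
every `x`, so that it covers the network at a time from which going straight home completes a tour
of duration at most `2 μ` (`IsTreeNetwork.exists_cover_time`).

It remains to see that the depth-first searches are the tours of duration at most `2 μ`. The arcs,
each taken in both directions, have total length `2 μ` (`IsTreeNetwork.sum_arcs`), so a depth-first
search is such a tour (`IsDF.exists_isTour`). In the other direction (`IsTour.isDF`), every directed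
arc has a time interval of at least its length during which the tour traverses it, and these
intervals are disjoint; there is no time left over, so the intervals in their order in time
are the steps of a depth-first search.

For the choice of the root, the expected time `μ - d̄(x)` of depth-first searches is smallest where
`d̄` is largest, and `d̄` has its maxima at leaves only, since at the midpoint of a path it is
strictly smaller than the average over the two ends (`IsTreeNetwork.exists_meanDist_lt`).
-/

namespace TreeSearch

variable {Q : Type*} [MetricSpace Q]

/-! ### Metric betweenness -/

theorem mem_path {x y z : Q} : z ∈ path x y ↔ dist x z + dist z y = dist x y := Iff.rfl

theorem path_comm (x y : Q) : path x y = path y x := by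
  ext z
  rw [mem_path, mem_path, dist_comm x z, dist_comm z y, dist_comm x y, add_comm]

theorem left_mem_path (x y : Q) : x ∈ path x y := by simp [mem_path]

theorem right_mem_path (x y : Q) : y ∈ path x y := by simp [mem_path]

theorem eq_of_mem_path_self {x z : Q} (h : z ∈ path x x) : z = x := by
  rw [mem_path, dist_comm z x, dist_self] at h
  have := dist_nonneg (x := x) (y := z)
  exact (dist_eq_zero.1 (by linarith)).symm

theorem mem_path_trans {x y z w : Q} (h : z ∈ path x y) (h' : w ∈ path x z) : w ∈ path x y := by
  rw [mem_path] at *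
  linarith [dist_triangle x w y, dist_triangle w z y]

theorem mem_path_shift {x y z w : Q} (h : z ∈ path x y) (h' : w ∈ path x z) : z ∈ path w y := by
  rw [mem_path] at *
  linarith [dist_triangle x w y, dist_triangle w z y]

theorem mem_path_trans' {x y z w : Q} (h : z ∈ path x y) (h' : w ∈ path z y) : w ∈ path x y := by
  rw [path_comm] at *
  exact mem_path_trans h h'

theorem mem_path_shift' {x y z w : Q} (h : z ∈ path x y) (h' : w ∈ path z y) : z ∈ path x w := by
  rw [path_comm] at *
  exact mem_path_shift h h'

/-- Two points that lie behind each other as seen from `x` are equal. -/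
theorem eq_of_mem_path_of_mem_path {x y z : Q} (h : z ∈ path x y) (h' : y ∈ path x z) : z = y := by
  rw [mem_path] at *
  have h0 := dist_nonneg (x := y) (y := z)
  rw [dist_comm z y] at h
  exact (dist_eq_zero.1 (by linarith)).symm

theorem eq_of_mem_path_inter {x y z w : Q} (h : z ∈ path x y) (h1 : w ∈ path x z)
    (h2 : w ∈ path z y) : w = z := by
  rw [mem_path] at *
  have := dist_triangle x w y
  rw [dist_comm z w] at h2
  have h0 := dist_nonneg (x := w) (y := z)
  exact dist_eq_zero.1 (by linarith)

theorem dist_le_of_mem_path {x y z : Q} (h : z ∈ path x y) : dist x z ≤ dist x y := by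
  rw [mem_path] at h
  linarith [dist_nonneg (x := z) (y := y)]

theorem isClosed_path (x y : Q) : IsClosed (path x y) :=
  isClosed_eq (by fun_prop) (by fun_prop)

theorem isClosed_setOf_mem_path (x z : Q) : IsClosed {w | z ∈ path x w} :=
  isClosed_eq (f := fun w => dist x z + dist z w) (g := fun w => dist x w)
    (by fun_prop) (by fun_prop)

/-! ### Geodesics and medians in a tree network -/

/-- An isometric parametrization of a path, made constant before the start and after the end. -/
theorem IsTreeNetwork.exists_lipschitz_geodesic (hQ : IsTreeNetwork Q) (x y : Q) :
    ∃ γ : ℝ → Q, LipschitzWith 1 γ ∧ (∀ t ≤ 0, γ t = x) ∧ (∀ t, dist x y ≤ t → γ t = y) ∧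
      ∀ s ∈ Icc 0 (dist x y), ∀ t ∈ Icc 0 (dist x y), dist (γ s) (γ t) = |s - t| := by
  obtain ⟨γ, h0, h1, h⟩ := hQ.geodesic x y
  have hd : (0 : ℝ) ≤ dist x y := dist_nonneg
  refine ⟨fun t => γ (projIcc 0 (dist x y) hd t), ?_, ?_, ?_, ?_⟩
  · refine LipschitzWith.mk_one fun s t => ?_
    rw [h _ (projIcc _ _ hd s).2 _ (projIcc _ _ hd t).2]
    exact (LipschitzWith.projIcc hd).dist_le_mul s t |>.trans (by simp)
  · intro t ht
    simp [projIcc_of_le_left hd ht, h0]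
  · intro t ht
    simp [projIcc_of_right_le hd ht, h1]
  · intro s hs t ht
    simp only [projIcc_of_mem hd hs, projIcc_of_mem hd ht]
    exact h s hs t ht

/-- Uniqueness of arcs for curves parametrized by intervals of arbitrary length. -/
theorem IsTreeNetwork.image_eq_of_injOn (hQ : IsTreeNetwork Q) {x y : Q} {f g : ℝ → Q} {a b : ℝ}
    (ha : 0 < a) (hb : 0 < b) (hf : Continuous f) (hg : Continuous g)
    (f0 : f 0 = x) (fa : f a = y) (g0 : g 0 = x) (gb : g b = y)
    (fi : InjOn f (Icc 0 a)) (gi : InjOn g (Icc 0 b)) :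
    f '' Icc 0 a = g '' Icc 0 b := by
  have key : ∀ (f : ℝ → Q) (a : ℝ), 0 < a → Continuous f → f 0 = x → f a = y →
      InjOn f (Icc 0 a) → ∃ p : Path x y, Function.Injective p ∧ range p = f '' Icc 0 a := by
    intro f a ha hf f0 fa fi
    have hmem : ∀ t : unitInterval, (t : ℝ) * a ∈ Icc 0 a := fun t =>
      ⟨mul_nonneg t.2.1 ha.le, mul_le_of_le_one_left ha.le t.2.2⟩
    refine ⟨⟨⟨fun t => f ((t : ℝ) * a), by fun_prop⟩, by simp [f0], by simp [fa]⟩, ?_, ?_⟩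
    · intro s t hst
      have := fi (hmem s) (hmem t) hst
      exact Subtype.ext (mul_right_cancel₀ ha.ne' this)
    · ext z
      constructor
      · rintro ⟨t, rfl⟩
        exact ⟨_, hmem t, rfl⟩
      · rintro ⟨t, ht, rfl⟩
        refine ⟨⟨t / a, div_nonneg ht.1 ha.le, (div_le_one ha).2 ht.2⟩, ?_⟩
        change f (t / a * a) = f t
        rw [div_mul_cancel₀ _ ha.ne']
  obtain ⟨p, hp, hp'⟩ := key f a ha hf f0 fa fi
  obtain ⟨q, hq, hq'⟩ := key g b hb hg g0 gb gi
  rw [← hp', ← hq']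
  exact hQ.uniqueArc x y p q hp hq

/-- Two paths that meet only at `m` join up to an injective curve, so that `m` lies on every
geodesic between their other ends. -/
theorem IsTreeNetwork.mem_image_geodesic (hQ : IsTreeNetwork Q) {x y m : Q}
    (h : path x m ∩ path m y ⊆ {m}) {γ : ℝ → Q} (hc : Continuous γ) (h0 : γ 0 = x)
    (h1 : γ (dist x y) = y)
    (hi : ∀ s ∈ Icc 0 (dist x y), ∀ t ∈ Icc 0 (dist x y), dist (γ s) (γ t) = |s - t|) :
    m ∈ γ '' Icc 0 (dist x y) := by
  have hd : (0 : ℝ) ≤ dist x y := dist_nonneg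
  rcases eq_or_ne x m with rfl | hxm
  · exact ⟨0, ⟨le_rfl, hd⟩, h0⟩
  rcases eq_or_ne m y with rfl | hmy
  · exact ⟨_, ⟨hd, le_rfl⟩, h1⟩
  have hxy : x ≠ y := by
    rintro rfl
    exact hxm (h ⟨left_mem_path _ _, right_mem_path _ _⟩)
  obtain ⟨γ₁, L1, z1, e1, i1⟩ := hQ.exists_lipschitz_geodesic x m
  obtain ⟨γ₂, L2, z2, e2, i2⟩ := hQ.exists_lipschitz_geodesic m y
  have d1 : 0 < dist x m := dist_pos.2 hxm
  have d2 : 0 < dist m y := dist_pos.2 hmy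
  have mem1 : ∀ t ∈ Icc 0 (dist x m), γ₁ t ∈ path x m := by
    intro t ht
    have h1 := i1 0 ⟨le_rfl, d1.le⟩ t ht
    have h2 := i1 t ht _ ⟨d1.le, le_rfl⟩
    rw [z1 0 le_rfl, zero_sub, abs_neg, abs_of_nonneg ht.1] at h1
    rw [e1 _ le_rfl, abs_of_nonpos (by linarith [ht.2])] at h2
    rw [mem_path, h1, h2]; ring
  have mem2 : ∀ t ∈ Icc 0 (dist m y), γ₂ t ∈ path m y := by
    intro t ht
    have h1 := i2 0 ⟨le_rfl, d2.le⟩ t ht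
    have h2 := i2 t ht _ ⟨d2.le, le_rfl⟩
    rw [z2 0 le_rfl, zero_sub, abs_neg, abs_of_nonneg ht.1] at h1
    rw [e2 _ le_rfl, abs_of_nonpos (by linarith [ht.2])] at h2
    rw [mem_path, h1, h2]; ring
  let f : ℝ → Q := fun t => if t ≤ dist x m then γ₁ t else γ₂ (t - dist x m)
  have hf : Continuous f := by
    refine Continuous.if_le L1.continuous (L2.continuous.comp (by fun_prop)) continuous_id
      continuous_const ?_
    rintro t rfl
    rw [e1 _ le_rfl, z2 _ (by simp)]
  have mixed : ∀ s ∈ Icc 0 (dist x m + dist m y), ∀ t ∈ Icc 0 (dist x m + dist m y),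
      s ≤ dist x m → ¬ t ≤ dist x m → γ₁ s ≠ γ₂ (t - dist x m) := by
    intro s hs t ht h1 h2 heq
    push Not at h2
    have ht' : t - dist x m ∈ Icc 0 (dist m y) := ⟨by linarith, by linarith [ht.2]⟩
    have hm : γ₂ (t - dist x m) = m :=
      h ⟨heq ▸ mem1 s ⟨hs.1, h1⟩, mem2 _ ht'⟩
    have := i2 0 ⟨le_rfl, d2.le⟩ _ ht'
    rw [z2 0 le_rfl, hm, dist_self, zero_sub, abs_neg, abs_of_nonneg ht'.1] at this
    linarith
  have hinj : InjOn f (Icc 0 (dist x m + dist m y)) := by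
    intro s hs t ht hst
    simp only [f] at hst
    split_ifs at hst with h1 h2 h2
    · have := i1 s ⟨hs.1, h1⟩ t ⟨ht.1, h2⟩
      rw [hst, dist_self] at this
      exact sub_eq_zero.1 (abs_eq_zero.1 this.symm)
    · exact absurd hst (mixed s hs t ht h1 h2)
    · exact absurd hst.symm (mixed t ht s hs h2 h1)
    · push Not at h1 h2
      have := i2 (s - dist x m) ⟨by linarith, by linarith [hs.2]⟩ (t - dist x m)
        ⟨by linarith, by linarith [ht.2]⟩
      rw [hst, dist_self] at this
      linarith [sub_eq_zero.1 (abs_eq_zero.1 this.symm)]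
  have ginj : InjOn γ (Icc 0 (dist x y)) := by
    intro s hs t ht hst
    have := hi s hs t ht
    rw [hst, dist_self] at this
    exact sub_eq_zero.1 (abs_eq_zero.1 this.symm)
  rw [← hQ.image_eq_of_injOn (f := f) (by positivity) (dist_pos.2 hxy) hf hc ?_ ?_ h0 h1 hinj ginj]
  · exact ⟨dist x m, ⟨d1.le, by linarith⟩, by simp [f, e1]⟩
  · simp [f, z1]
  · have : ¬ dist x m + dist m y ≤ dist x m := by linarith
    simp only [f, this, if_false]
    exact e2 _ (by linarith)

/-- The path between two points is exactly the image of a geodesic. -/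
theorem IsTreeNetwork.exists_geodesic (hQ : IsTreeNetwork Q) (x y : Q) :
    ∃ γ : ℝ → Q, LipschitzWith 1 γ ∧ (∀ t ≤ 0, γ t = x) ∧ (∀ t, dist x y ≤ t → γ t = y) ∧
      (∀ s ∈ Icc 0 (dist x y), ∀ t ∈ Icc 0 (dist x y), dist (γ s) (γ t) = |s - t|) ∧
      γ '' Icc 0 (dist x y) = path x y ∧ ∀ z ∈ path x y, γ (dist x z) = z := by
  obtain ⟨γ, hL, h0, h1, hi⟩ := hQ.exists_lipschitz_geodesic x y
  have hd : (0 : ℝ) ≤ dist x y := dist_nonneg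
  have hdist : ∀ t ∈ Icc 0 (dist x y), dist x (γ t) = t := by
    intro t ht
    have := hi 0 ⟨le_rfl, hd⟩ t ht
    rwa [h0 0 le_rfl, zero_sub, abs_neg, abs_of_nonneg ht.1] at this
  have himg : γ '' Icc 0 (dist x y) = path x y := by
    apply Subset.antisymm
    · rintro _ ⟨t, ht, rfl⟩
      have h3 := hi t ht _ ⟨hd, le_rfl⟩
      rw [h1 _ le_rfl, abs_of_nonpos (by linarith [ht.2])] at h3
      rw [mem_path, hdist t ht, h3]; ring
    · intro z hz
      refine hQ.mem_image_geodesic (fun w hw => ?_) hL.continuous (h0 0 le_rfl) (h1 _ le_rfl) hi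
      exact eq_of_mem_path_inter hz hw.1 hw.2
  refine ⟨γ, hL, h0, h1, hi, himg, fun z hz => ?_⟩
  rw [← himg] at hz
  obtain ⟨t, ht, rfl⟩ := hz
  rw [hdist t ht]

theorem IsTreeNetwork.isCompact_path (hQ : IsTreeNetwork Q) (x y : Q) : IsCompact (path x y) := by
  obtain ⟨γ, hL, -, -, -, himg, -⟩ := hQ.exists_geodesic x y
  exact himg ▸ isCompact_Icc.image hL.continuous

theorem IsTreeNetwork.isPreconnected_path (hQ : IsTreeNetwork Q) (x y : Q) :
    IsPreconnected (path x y) := by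
  obtain ⟨γ, hL, -, -, -, himg, -⟩ := hQ.exists_geodesic x y
  exact himg ▸ isPreconnected_Icc.image _ hL.continuous.continuousOn

theorem IsTreeNetwork.exists_mem_path_dist_eq (hQ : IsTreeNetwork Q) (x y : Q) {r : ℝ}
    (h0 : 0 ≤ r) (h1 : r ≤ dist x y) : ∃ z ∈ path x y, dist x z = r := by
  obtain ⟨γ, hL, z0, -, hi, himg, -⟩ := hQ.exists_geodesic x y
  refine ⟨γ r, himg ▸ ⟨r, ⟨h0, h1⟩, rfl⟩, ?_⟩
  have := hi 0 ⟨le_rfl, dist_nonneg⟩ r ⟨h0, h1⟩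
  rwa [z0 0 le_rfl, zero_sub, abs_neg, abs_of_nonneg h0] at this

theorem IsTreeNetwork.eq_of_dist_eq (hQ : IsTreeNetwork Q) {x y z w : Q} (hz : z ∈ path x y)
    (hw : w ∈ path x y) (h : dist x z = dist x w) : z = w := by
  obtain ⟨γ, -, -, -, -, -, hγ⟩ := hQ.exists_geodesic x y
  rw [← hγ z hz, ← hγ w hw, h]

theorem IsTreeNetwork.mem_path_of_dist_le (hQ : IsTreeNetwork Q) {x y z w : Q} (hz : z ∈ path x y)
    (hw : w ∈ path x y) (h : dist x z ≤ dist x w) : z ∈ path x w := by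
  obtain ⟨γ, -, -, -, hi, -, hγ⟩ := hQ.exists_geodesic x y
  have := hi (dist x z) ⟨dist_nonneg, dist_le_of_mem_path hz⟩ (dist x w)
    ⟨dist_nonneg, dist_le_of_mem_path hw⟩
  rw [hγ z hz, hγ w hw, abs_of_nonpos (by linarith)] at this
  rw [mem_path, this]; ring

theorem IsTreeNetwork.mem_path_or_mem_path (hQ : IsTreeNetwork Q) {x y z w : Q}
    (hz : z ∈ path x y) (hw : w ∈ path x y) : w ∈ path x z ∨ w ∈ path z y := by
  rcases le_total (dist x z) (dist x w) with h | h
  · exact Or.inr (mem_path_shift hw (hQ.mem_path_of_dist_le hz hw h))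
  · exact Or.inl (hQ.mem_path_of_dist_le hw hz h)

/-- Any three points of a tree have a median: a point that lies between any two of them. -/
theorem IsTreeNetwork.exists_median (hQ : IsTreeNetwork Q) (x y z : Q) :
    ∃ m, m ∈ path x y ∧ m ∈ path y z ∧ m ∈ path x z := by
  obtain ⟨m, ⟨hm1, hm2⟩, hmax⟩ :=
    ((hQ.isCompact_path x y).inter_right (isClosed_path x z)).exists_isMaxOn
      ⟨x, left_mem_path _ _, left_mem_path _ _⟩ (f := fun w => dist x w) (by fun_prop)
  refine ⟨m, hm1, ?_, hm2⟩
  obtain ⟨γ, hL, z0, z1, hi, himg, -⟩ := hQ.exists_geodesic y z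
  rw [← himg]
  refine hQ.mem_image_geodesic ?_ hL.continuous (z0 0 le_rfl) (z1 _ le_rfl) hi
  rintro w ⟨hw1, hw2⟩
  rw [path_comm] at hw1
  have h1 := mem_path_trans' hm1 hw1
  have h2 := mem_path_trans' hm2 hw2
  have h3 : dist x w ≤ dist x m := hmax (show w ∈ path x y ∩ path x z from ⟨h1, h2⟩)
  have h4 := mem_path.1 (mem_path_shift' hm1 hw1)
  exact (dist_eq_zero.1 (by linarith [dist_nonneg (x := m) (y := w)])).symm

theorem IsTreeNetwork.path_subset_union (hQ : IsTreeNetwork Q) (x y z : Q) :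
    path x z ⊆ path x y ∪ path y z := by
  intro w hw
  obtain ⟨m, h1, h2, h3⟩ := hQ.exists_median x y z
  rcases hQ.mem_path_or_mem_path h3 hw with h | h
  · exact Or.inl (mem_path_trans h1 h)
  · exact Or.inr (mem_path_trans' h2 h)

theorem IsTreeNetwork.notMem_path_trans (hQ : IsTreeNetwork Q) {x y z w : Q} (h1 : w ∉ path x y)
    (h2 : w ∉ path y z) : w ∉ path x z := fun h =>
  (hQ.path_subset_union x y z h).elim h1 h2

/-- Connected sets are convex: removing a point between `x` and `y` separates them. -/
theorem IsTreeNetwork.path_subset_of_isPreconnected (hQ : IsTreeNetwork Q) {C : Set Q}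
    (hC : IsPreconnected C) {x y : Q} (hx : x ∈ C) (hy : y ∈ C) : path x y ⊆ C := by
  intro z hz
  by_contra hzC
  have hzx : z ≠ x := fun h => hzC (h ▸ hx)
  have hzy : z ≠ y := fun h => hzC (h ▸ hy)
  have hU : IsOpen {w | z ∉ path x w} := (isClosed_setOf_mem_path x z).isOpen_compl
  have hV : IsOpen {w | z ∈ path x w ∧ w ≠ z} := by
    rw [Metric.isOpen_iff]
    rintro w ⟨hw, hwz⟩
    refine ⟨dist w z, dist_pos.2 hwz, fun w' hw' => ?_⟩
    rw [Metric.mem_ball] at hw'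
    have hn : z ∉ path w' w := fun h => by
      have := dist_le_of_mem_path ((path_comm w' w) ▸ h)
      rw [dist_comm w' w] at hw'
      linarith
    refine ⟨by_contra fun h => hQ.notMem_path_trans h hn hw, ?_⟩
    rintro rfl
    exact hn (left_mem_path _ _)
  obtain ⟨w, -, hw1, hw2⟩ := hC _ _ hU hV
    (fun w hw => by
      by_cases h : z ∈ path x w
      · exact Or.inr ⟨h, fun h' => hzC (h' ▸ hw)⟩
      · exact Or.inl h)
    ⟨x, hx, fun h => hzx (eq_of_mem_path_self h)⟩ ⟨y, hy, hz, hzy.symm⟩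
  exact hw1 hw2.1

/-- A continuous curve passes through every point between two of its points. -/
theorem IsTreeNetwork.exists_eq_of_mem_path (hQ : IsTreeNetwork Q) {f : ℝ → Q} (hf : Continuous f)
    {s t : ℝ} (hst : s ≤ t) {z : Q} (hz : z ∈ path (f s) (f t)) : ∃ r ∈ Icc s t, f r = z :=
  hQ.path_subset_of_isPreconnected (isPreconnected_Icc.image f hf.continuousOn)
    (mem_image_of_mem f (left_mem_Icc.2 hst)) (mem_image_of_mem f (right_mem_Icc.2 hst)) hz

/-! ### Branches at a point and the degree -/

/-- Every path can be prolonged to a path that ends in one of finitely many points. -/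
theorem IsTreeNetwork.exists_finite_ends (hQ : IsTreeNetwork Q) :
    ∃ F : Set Q, F.Finite ∧ ∀ x q : Q, ∃ f ∈ F, q ∈ path x f := by
  obtain ⟨F, hF, h⟩ := hQ.finiteArcs
  refine ⟨F, hF, fun x q => ?_⟩
  obtain ⟨a, ha, b, hb, hq⟩ := h q
  by_contra! hc
  exact hQ.notMem_path_trans (path_comm x a ▸ hc a ha) (hc b hb) hq

/-- The components of the complement of `x` are the classes of points not separated by `x`. -/
theorem IsTreeNetwork.mk_eq_mk_iff (hQ : IsTreeNetwork Q) {x : Q} (p q : ({x}ᶜ : Set Q)) :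
    (ConnectedComponents.mk p = ConnectedComponents.mk q) ↔ x ∉ path (p : Q) q := by
  rw [ConnectedComponents.coe_eq_coe']
  constructor
  · intro h hx
    have h1 : IsPreconnected (Subtype.val '' connectedComponent q : Set Q) :=
      isPreconnected_connectedComponent.image _ continuous_subtype_val.continuousOn
    have := hQ.path_subset_of_isPreconnected h1 (mem_image_of_mem _ h)
      (mem_image_of_mem _ mem_connectedComponent) hx
    obtain ⟨z, -, hz⟩ := this
    exact z.2 hz
  · intro hx
    have h1 : IsPreconnected (Subtype.val ⁻¹' path (p : Q) q : Set ({x}ᶜ : Set Q)) := by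
      rw [← Topology.IsInducing.subtypeVal.isPreconnected_image, Subtype.image_preimage_coe,
        inter_eq_self_of_subset_right]
      · exact hQ.isPreconnected_path p q
      · rintro z hz rfl
        exact hx hz
    exact h1.subset_connectedComponent (right_mem_path (p : Q) q) (left_mem_path (p : Q) q)

theorem IsTreeNetwork.finite_components (hQ : IsTreeNetwork Q) (x : Q) :
    Finite (ConnectedComponents ({x}ᶜ : Set Q)) := by
  obtain ⟨F, hF, h⟩ := hQ.exists_finite_ends
  have : Finite (Subtype.val ⁻¹' F : Set ({x}ᶜ : Set Q)) :=
    (hF.preimage Subtype.val_injective.injOn).to_subtype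
  refine Finite.of_surjective
    (fun f : (Subtype.val ⁻¹' F : Set ({x}ᶜ : Set Q)) => ConnectedComponents.mk f.1) ?_
  intro c
  obtain ⟨q, rfl⟩ := ConnectedComponents.surjective_coe c
  obtain ⟨f, hf, hq⟩ := h x q
  have hqx : (q : Q) ≠ x := q.2
  have hfx : f ≠ x := by
    rintro rfl
    exact hqx (eq_of_mem_path_self hq)
  refine ⟨⟨⟨f, hfx⟩, hf⟩, ?_⟩
  change ConnectedComponents.mk _ = ConnectedComponents.mk _
  rw [hQ.mk_eq_mk_iff]
  intro hx
  change x ∈ path f q at hx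
  rw [path_comm] at hx
  exact hqx (eq_of_mem_path_inter hq (left_mem_path _ _) hx).symm

theorem IsTreeNetwork.isLeaf_iff [Nontrivial Q] (hQ : IsTreeNetwork Q) {x : Q} :
    IsLeaf x ↔ ∀ p q : Q, p ≠ x → q ≠ x → x ∉ path p q := by
  rw [IsLeaf, degree, Nat.card_eq_one_iff_unique]
  constructor
  · rintro ⟨h, -⟩ p q hp hq
    exact (hQ.mk_eq_mk_iff ⟨p, hp⟩ ⟨q, hq⟩).1 (Subsingleton.elim _ _)
  · intro h
    obtain ⟨y, hy⟩ := exists_ne x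
    refine ⟨⟨fun c d => ?_⟩, ⟨ConnectedComponents.mk ⟨y, hy⟩⟩⟩
    obtain ⟨p, rfl⟩ := ConnectedComponents.surjective_coe c
    obtain ⟨q, rfl⟩ := ConnectedComponents.surjective_coe d
    exact (hQ.mk_eq_mk_iff p q).2 (h p q p.2 q.2)

/-- A point that separates three points from one another is a branch point. -/
theorem IsTreeNetwork.degree_ne_two (hQ : IsTreeNetwork Q) {x p q r : Q} (hp : p ≠ x) (hq : q ≠ x)
    (hr : r ≠ x) (hpq : x ∈ path p q) (hqr : x ∈ path q r) (hpr : x ∈ path p r) :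
    degree x ≠ 2 := by
  intro h
  obtain ⟨a, b, hab, huniv⟩ := Nat.card_eq_two_iff.1 h
  have key : ∀ c : ConnectedComponents ({x}ᶜ : Set Q), c = a ∨ c = b := fun c => by
    have : c ∈ ({a, b} : Set _) := huniv ▸ mem_univ c
    simpa using this
  have n1 := mt (hQ.mk_eq_mk_iff ⟨p, hp⟩ ⟨q, hq⟩).1 (not_not.2 hpq)
  have n2 := mt (hQ.mk_eq_mk_iff ⟨q, hq⟩ ⟨r, hr⟩).1 (not_not.2 hqr)
  have n3 := mt (hQ.mk_eq_mk_iff ⟨p, hp⟩ ⟨r, hr⟩).1 (not_not.2 hpr)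
  rcases key (ConnectedComponents.mk ⟨p, hp⟩) with h1 | h1 <;>
  rcases key (ConnectedComponents.mk ⟨q, hq⟩) with h2 | h2 <;>
  rcases key (ConnectedComponents.mk ⟨r, hr⟩) with h3 | h3 <;>
  simp_all

/-- Conversely, a point of degree neither one nor two separates three points. -/
theorem IsTreeNetwork.exists_three [Nontrivial Q] (hQ : IsTreeNetwork Q) {x : Q}
    (h1 : degree x ≠ 1) (h2 : degree x ≠ 2) :
    ∃ p q r : Q, x ∈ path p q ∧ x ∈ path q r ∧ x ∈ path p r ∧ p ≠ x ∧ q ≠ x ∧ r ≠ x := by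
  have hfin := hQ.finite_components x
  have := Fintype.ofFinite (ConnectedComponents ({x}ᶜ : Set Q))
  have h0 : degree x ≠ 0 := by
    obtain ⟨y, hy⟩ := exists_ne x
    have : Nonempty (ConnectedComponents ({x}ᶜ : Set Q)) := ⟨ConnectedComponents.mk ⟨y, hy⟩⟩
    exact Nat.card_pos.ne'
  have h3 : 2 < Fintype.card (ConnectedComponents ({x}ᶜ : Set Q)) := by
    rw [← Nat.card_eq_fintype_card]
    change 2 < degree x
    omega
  obtain ⟨a, b, c, hab, hac, hbc⟩ := Fintype.two_lt_card_iff.1 h3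
  obtain ⟨p, rfl⟩ := ConnectedComponents.surjective_coe a
  obtain ⟨q, rfl⟩ := ConnectedComponents.surjective_coe b
  obtain ⟨r, rfl⟩ := ConnectedComponents.surjective_coe c
  exact ⟨p, q, r, not_not.1 (mt (hQ.mk_eq_mk_iff p q).2 hab),
    not_not.1 (mt (hQ.mk_eq_mk_iff q r).2 hbc), not_not.1 (mt (hQ.mk_eq_mk_iff p r).2 hac),
    p.2, q.2, r.2⟩

theorem IsTreeNetwork.finite_setOf_isLeaf [Nontrivial Q] (hQ : IsTreeNetwork Q) :
    {x : Q | IsLeaf x}.Finite := by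
  obtain ⟨F, hF, h⟩ := hQ.exists_finite_ends
  refine hF.subset fun x hx => ?_
  obtain ⟨y, hy⟩ := exists_ne x
  obtain ⟨f, hf, hxf⟩ := h y x
  by_contra hxF
  exact hQ.isLeaf_iff.1 hx y f hy (fun h => hxF (h ▸ hf)) hxf

/-- Every nontrivial path can be prolonged to a path that ends in a leaf. -/
theorem IsTreeNetwork.exists_isLeaf_mem_path [Nontrivial Q] (hQ : IsTreeNetwork Q) {x y : Q}
    (hxy : y ≠ x) : ∃ l, IsLeaf l ∧ y ∈ path x l := by
  obtain ⟨F, hF, h⟩ := hQ.exists_finite_ends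
  have hfin : {f ∈ F | y ∈ path x f}.Finite := hF.subset fun f hf => hf.1
  obtain ⟨f₀, hf₀, hy₀⟩ := h x y
  obtain ⟨l, ⟨hlF, hyl⟩, hmax⟩ := hfin.exists_maximalFor (fun f => dist x f) _ ⟨f₀, hf₀, hy₀⟩
  refine ⟨l, hQ.isLeaf_iff.2 ?_, hyl⟩
  have hlx : l ≠ x := by
    rintro rfl
    exact hxy (eq_of_mem_path_self hyl)
  have key : ∀ p, p ≠ l → l ∉ path x p := by
    intro p hp hlp
    obtain ⟨f, hf, hpf⟩ := h x p
    have hlf := mem_path_trans hpf hlp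
    have h1 : dist x f ≤ dist x l :=
      hmax ⟨hf, mem_path_trans hlf hyl⟩ (dist_le_of_mem_path hlf)
    have h2 := mem_path.1 hlp
    have h3 := dist_le_of_mem_path hpf
    have := dist_pos.2 hp.symm
    linarith
  intro p q hp hq
  exact hQ.notMem_path_trans (path_comm x p ▸ key p hp) (key q hq)

/-! ### Nodes and arcs -/

theorem IsTreeNetwork.finite_setOf_isNode [Nontrivial Q] (hQ : IsTreeNetwork Q) (O : Q) :
    {x | IsNode O x}.Finite := by
  obtain ⟨F, hF, h⟩ := hQ.exists_finite_ends
  have hmed : (⋃ a ∈ F, ⋃ b ∈ F, ⋃ c ∈ F,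
      {m : Q | m ∈ path a b ∧ m ∈ path b c ∧ m ∈ path a c}).Finite := by
    refine hF.biUnion fun a _ => hF.biUnion fun b _ => hF.biUnion fun c _ =>
      Set.Subsingleton.finite ?_
    rintro m ⟨h1, h2, h3⟩ m' ⟨h1', h2', h3'⟩
    refine hQ.eq_of_dist_eq h1 h1' ?_
    rw [mem_path] at *
    rw [dist_comm m b] at h1
    rw [dist_comm m' b] at h1'
    linarith
  refine ((finite_singleton O).union (hQ.finite_setOf_isLeaf.union hmed)).subset ?_
  rintro x (hx | hx)
  · exact Or.inl hx
  · by_cases h1 : degree x = 1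
    · exact Or.inr (Or.inl h1)
    · refine Or.inr (Or.inr ?_)
      obtain ⟨p, q, r, hpq, hqr, hpr, hp, hq, hr⟩ := hQ.exists_three h1 hx
      have ext : ∀ p, p ≠ x → ∃ f ∈ F, x ∉ path p f := by
        intro p hp
        obtain ⟨f, hf, hpf⟩ := h x p
        exact ⟨f, hf, fun h => hp (eq_of_mem_path_inter hpf (left_mem_path _ _) h).symm⟩
      obtain ⟨a, ha, hpa⟩ := ext p hp
      obtain ⟨b, hb, hqb⟩ := ext q hq
      obtain ⟨c, hc, hrc⟩ := ext r hr
      have sep : ∀ {p q a b : Q}, x ∈ path p q → x ∉ path p a → x ∉ path q b → x ∈ path a b := by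
        intro p q a b h1 h2 h3
        by_contra h4
        exact hQ.notMem_path_trans (hQ.notMem_path_trans h2 h4) (path_comm q b ▸ h3) h1
      simp only [mem_iUnion]
      exact ⟨a, ha, b, hb, c, hc, sep hpq hpa hqb, sep hqr hqb hrc, sep hpr hpa hrc⟩

theorem IsArc.symm {O a b : Q} (h : IsArc O a b) : IsArc O b a :=
  ⟨h.2.1, h.1, h.2.2.1.symm, fun z hz hn => (h.2.2.2 z (path_comm b a ▸ hz) hn).symm⟩

theorem IsTreeNetwork.finite_setOf_isArc [Nontrivial Q] (hQ : IsTreeNetwork Q) (O : Q) :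
    {p : Q × Q | IsArc O p.1 p.2}.Finite :=
  ((hQ.finite_setOf_isNode O).prod (hQ.finite_setOf_isNode O)).subset fun _ h => ⟨h.1, h.2.1⟩

/-- No branch leaves an arc at an interior point: the median of the end nodes of an arc with a
point `w` is an end node or `w` itself. -/
theorem IsTreeNetwork.mem_path_of_isArc (hQ : IsTreeNetwork Q) {O a b w : Q} (h : IsArc O a b)
    (ha : a ∉ path w b) (hb : b ∉ path a w) : w ∈ path a b := by
  obtain ⟨m, h1, h2, h3⟩ := hQ.exists_median a w b
  rcases eq_or_ne m w with rfl | hmw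
  · exact h3
  have hma : m ≠ a := fun h => ha (h ▸ h2)
  have hmb : m ≠ b := fun h => hb (h ▸ h1)
  rcases h.2.2.2 m h3 (Or.inr (hQ.degree_ne_two hma.symm hmw.symm hmb.symm h1 h2 h3)) with h | h
  · exact absurd h hma
  · exact absurd h hmb

theorem IsTreeNetwork.mem_path_root (hQ : IsTreeNetwork Q) {O a b : Q} (h : IsArc O a b) :
    a ∈ path O b ∨ b ∈ path O a := by
  by_contra! hc
  have hO := hQ.mem_path_of_isArc h hc.1 (path_comm O a ▸ hc.2)
  rcases h.2.2.2 O hO (Or.inl rfl) with h | h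
  · exact hc.1 (h ▸ left_mem_path _ _)
  · exact hc.2 (h ▸ left_mem_path _ _)

theorem IsArc.not_mem_path {O a b : Q} (h : IsArc O a b) (hab : a ∈ path O b) : b ∉ path O a :=
  fun hba => h.2.2.1 (eq_of_mem_path_of_mem_path hab hba)

theorem IsTreeNetwork.exists_isArc_mem_path [Nontrivial Q] (hQ : IsTreeNetwork Q) {O z : Q}
    (hz : z ≠ O) : ∃ a b, IsArc O a b ∧ a ∈ path O b ∧ z ∈ path a b ∧ z ≠ a := by
  have hN := hQ.finite_setOf_isNode O
  obtain ⟨l, hl, hzl⟩ := hQ.exists_isLeaf_mem_path hz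
  have hB : {b | IsNode O b ∧ z ∈ path O b}.Finite := hN.subset fun b hb => hb.1
  have hA : {a | IsNode O a ∧ a ∈ path O z ∧ a ≠ z}.Finite := hN.subset fun a ha => ha.1
  obtain ⟨b, ⟨hb, hzb⟩, hbmin⟩ := hB.exists_minimalFor (fun b => dist z b) _
    ⟨l, Or.inr (by rw [show degree l = 1 from hl]; decide), hzl⟩
  obtain ⟨a, ⟨ha, haz, hne⟩, hamin⟩ := hA.exists_minimalFor (fun a => dist a z) _
    ⟨O, Or.inl rfl, left_mem_path _ _, hz.symm⟩
  have hzab := mem_path_shift hzb haz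
  refine ⟨a, b, ⟨ha, hb, ?_, ?_⟩, mem_path_trans hzb haz, hzab, hne.symm⟩
  · rintro rfl
    exact hne (eq_of_mem_path_self hzab).symm
  · intro n hn hnode
    have key : n ∈ path z b → n = b := by
      intro hn'
      have h1 := mem_path_shift' hzb hn'
      have h2 : dist z b ≤ dist z n :=
        hbmin ⟨hnode, h1⟩ (dist_le_of_mem_path hn')
      have h3 := mem_path.1 hn'
      exact dist_eq_zero.1 (by linarith [dist_nonneg (x := n) (y := b)])
    rcases hQ.mem_path_or_mem_path hzab hn with h | h
    · rcases eq_or_ne n z with rfl | hnz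
      · exact Or.inr (key (left_mem_path _ _))
      · have h1 := mem_path_trans' haz h
        have h3 := mem_path.1 h
        have h2 : dist a z ≤ dist n z :=
          hamin ⟨hnode, h1, hnz⟩ (by simp only; linarith [dist_nonneg (x := a) (y := n)])
        exact Or.inl (dist_eq_zero.1 (by linarith [dist_nonneg (x := a) (y := n)])).symm
    · exact Or.inr (key h)

/-- Arcs directed away from the root that share a point other than their starts are equal. -/
theorem IsTreeNetwork.eq_of_mem_arcs (hQ : IsTreeNetwork Q) {O a b a' b' z : Q} (h : IsArc O a b)
    (h' : IsArc O a' b') (hab : a ∈ path O b) (hab' : a' ∈ path O b') (hz : z ∈ path a b)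
    (hz' : z ∈ path a' b') (hza : z ≠ a) (hza' : z ≠ a') : a = a' ∧ b = b' := by
  have key : ∀ {a b a' b' : Q}, IsArc O a b → IsArc O a' b' → a ∈ path O b → a' ∈ path O b' →
      z ∈ path a b → z ∈ path a' b' → z ≠ a → z ≠ a' → a' ∈ path a z → a = a' := by
    intro a b a' b' h h' hab hab' hz hz' hza hza' hm
    rcases h.2.2.2 a' (mem_path_trans hz hm) h'.1 with h1 | h1
    · exact h1.symm
    · subst h1
      exact absurd (eq_of_mem_path_of_mem_path hz hm) hza'
  have ha := mem_path_shift' hab hz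
  have ha' := mem_path_shift' hab' hz'
  have haa : a = a' := by
    rcases hQ.mem_path_or_mem_path ha ha' with h1 | h1
    · exact (key h' h hab' hab hz' hz hza' hza (mem_path_shift ha h1)).symm
    · exact key h h' hab hab' hz hz' hza hza' h1
  subst haa
  refine ⟨rfl, ?_⟩
  obtain ⟨m, h1, h2, h3⟩ := hQ.exists_median b z b'
  have hmb : m ∈ path a b := mem_path_trans' hz (path_comm b z ▸ h1)
  have hmb' : m ∈ path a b' := mem_path_trans' hz' h2
  have hzm : z ∈ path a m := mem_path_shift' hz (path_comm b z ▸ h1)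
  have hma : m ≠ a := by
    rintro rfl
    exact hza (eq_of_mem_path_self hzm)
  by_cases e1 : m = b
  · exact (h'.2.2.2 b (e1 ▸ hmb') h.2.1).resolve_left h.2.2.1.symm
  by_cases e2 : m = b'
  · exact ((h.2.2.2 b' (e2 ▸ hmb) h'.2.1).resolve_left h'.2.2.1.symm).symm
  rcases h.2.2.2 m hmb (Or.inr (hQ.degree_ne_two (Ne.symm hma) (Ne.symm e1) (Ne.symm e2)
    hmb h3 hmb')) with h | h
  · exact absurd h hma
  · exact absurd h e1

/-- Two arcs with a common interior point agree up to direction. -/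
theorem IsTreeNetwork.eq_or_eq_swap (hQ : IsTreeNetwork Q) {O z : Q} {p q : Q × Q}
    (h : IsArc O p.1 p.2) (h' : IsArc O q.1 q.2) (hz : z ∈ path p.1 p.2) (hz' : z ∈ path q.1 q.2)
    (h1 : z ≠ p.1) (h2 : z ≠ p.2) (h1' : z ≠ q.1) (h2' : z ≠ q.2) : q = p ∨ q = p.swap := by
  obtain ⟨a, b⟩ := p
  obtain ⟨c, d⟩ := q
  simp only [Prod.swap_prod_mk, Prod.mk.injEq] at *
  rcases hQ.mem_path_root h with ha | ha <;> rcases hQ.mem_path_root h' with hc | hc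
  · have := hQ.eq_of_mem_arcs h h' ha hc hz hz' h1 h1'
    exact Or.inl ⟨this.1.symm, this.2.symm⟩
  · have := hQ.eq_of_mem_arcs h h'.symm ha hc hz (path_comm c d ▸ hz') h1 h2'
    exact Or.inr ⟨this.2.symm, this.1.symm⟩
  · have := hQ.eq_of_mem_arcs h.symm h' ha hc (path_comm a b ▸ hz) hz' h2 h1'
    exact Or.inr ⟨this.1.symm, this.2.symm⟩
  · have := hQ.eq_of_mem_arcs h.symm h'.symm ha hc (path_comm a b ▸ hz) (path_comm c d ▸ hz') h2 h2'
    exact Or.inl ⟨this.2.symm, this.1.symm⟩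

section

/-! ### The length measure -/

theorem IsTreeNetwork.exists_iUnion_path_eq_univ (hQ : IsTreeNetwork Q) (x : Q) :
    ∃ F : Set Q, F.Finite ∧ ⋃ f ∈ F, path x f = univ := by
  obtain ⟨F, hF, h⟩ := hQ.exists_finite_ends
  refine ⟨F, hF, eq_univ_of_forall fun q => ?_⟩
  obtain ⟨f, hf, hq⟩ := h x q
  exact mem_biUnion hf hq

theorem IsTreeNetwork.compactSpace (hQ : IsTreeNetwork Q) : CompactSpace Q := by
  cases isEmpty_or_nonempty Q
  · infer_instance
  obtain ⟨x⟩ := ‹Nonempty Q›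
  obtain ⟨F, hF, h⟩ := hQ.exists_iUnion_path_eq_univ x
  exact ⟨h ▸ hF.isCompact_biUnion fun f _ => hQ.isCompact_path x f⟩

variable [MeasurableSpace Q] [BorelSpace Q]

instance nullSingletonClass_lengthMeasure : NullSingletonClass (lengthMeasure Q) :=
  Measure.nullSingletonClass_hausdorff Q one_pos

theorem IsTreeNetwork.lengthMeasure_path (hQ : IsTreeNetwork Q) (x y : Q) :
    lengthMeasure Q (path x y) = ENNReal.ofReal (dist x y) := by
  obtain ⟨γ, hL, z0, -, hi, himg, -⟩ := hQ.exists_geodesic x y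
  have hiso : Isometry (fun t : Icc (0 : ℝ) (dist x y) => γ t) :=
    Isometry.of_dist_eq fun s t => by
      rw [hi s s.2 t t.2, Subtype.dist_eq, Real.dist_eq]
  have h1 : path x y = (fun t : Icc (0 : ℝ) (dist x y) => γ t) '' univ := by
    rw [← himg, image_univ, image_eq_range]
  rw [lengthMeasure, h1, hiso.hausdorffMeasure_image (Or.inl zero_le_one),
    ← isometry_subtype_coe.hausdorffMeasure_image (Or.inl zero_le_one), image_univ,
    Subtype.range_coe, hausdorffMeasure_real, Real.volume_Icc, sub_zero]

theorem IsTreeNetwork.isFiniteMeasure (hQ : IsTreeNetwork Q) :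
    IsFiniteMeasure (lengthMeasure Q) := by
  cases isEmpty_or_nonempty Q
  · infer_instance
  obtain ⟨x⟩ := ‹Nonempty Q›
  obtain ⟨F, hF, h⟩ := hQ.exists_iUnion_path_eq_univ x
  refine ⟨?_⟩
  rw [← h]
  refine (measure_biUnion_lt_top hF fun f _ => ?_)
  rw [hQ.lengthMeasure_path]
  exact ENNReal.ofReal_lt_top

theorem IsTreeNetwork.real_path (hQ : IsTreeNetwork Q) (x y : Q) :
    (lengthMeasure Q).real (path x y) = dist x y := by
  rw [Measure.real, hQ.lengthMeasure_path, ENNReal.toReal_ofReal dist_nonneg]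

theorem real_univ_eq_totalLength : (lengthMeasure Q).real univ = totalLength Q := rfl

theorem IsTreeNetwork.lengthMeasure_pos [Nontrivial Q] (hQ : IsTreeNetwork Q) {U : Set Q}
    (hU : IsOpen U) (hne : U.Nonempty) : 0 < lengthMeasure Q U := by
  obtain ⟨x, hx⟩ := hne
  obtain ⟨y, hy⟩ := exists_ne x
  obtain ⟨r, hr, hball⟩ := Metric.isOpen_iff.1 hU x hx
  have hd := dist_pos.2 hy.symm
  obtain ⟨z, -, hzr⟩ := hQ.exists_mem_path_dist_eq x y (r := min (r / 2) (dist x y))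
    (by positivity) (min_le_right _ _)
  have hsub : path x z ⊆ U := fun w hw => hball (by
    rw [Metric.mem_ball, dist_comm]
    have := dist_le_of_mem_path hw
    have := min_le_left (r / 2) (dist x y)
    linarith)
  refine lt_of_lt_of_le ?_ (measure_mono hsub)
  rw [hQ.lengthMeasure_path, hzr]
  exact ENNReal.ofReal_pos.2 (by positivity)

theorem IsTreeNetwork.totalLength_pos [Nontrivial Q] (hQ : IsTreeNetwork Q) :
    0 < totalLength Q := by
  have := hQ.isFiniteMeasure
  exact ENNReal.toReal_pos (hQ.lengthMeasure_pos isOpen_univ univ_nonempty).ne'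
    (measure_ne_top _ _)

/-! ### The time needed to cover a set -/

/-- The bound for the hull of finitely many points of a curve. When a point `f a` is added, the
hull grows at most by the path from the median `m` of the start, the previous point and `f a`
to `f a`, while time plus distance from the start grow by at least twice the length of that path. -/
theorem IsTreeNetwork.two_mul_length_hull_le (hQ : IsTreeNetwork Q) {f : ℝ → Q}
    (hf : LipschitzWith 1 f) (s : ℝ) (T : Finset ℝ) (hT : ∀ r ∈ T, s ≤ r) :
    ∃ τ ∈ insert s T, (∀ r ∈ T, r ≤ τ) ∧
      2 * (lengthMeasure Q).real (⋃ r ∈ insert s T, path (f s) (f r)) ≤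
        τ - s + dist (f s) (f τ) := by
  have := hQ.isFiniteMeasure
  induction T using Finset.induction_on_max with
  | empty =>
    refine ⟨s, by simp, by simp, ?_⟩
    simp [hQ.real_path]
  | insert a T hmax ih =>
    obtain ⟨τ, hτ, hle, ih⟩ := ih fun r hr => hT r (Finset.mem_insert_of_mem hr)
    have hτa : τ ≤ a := by
      rcases Finset.mem_insert.1 hτ with rfl | h
      · exact hT a (Finset.mem_insert_self _ _)
      · exact (hmax τ h).le
    refine ⟨a, by simp, fun r hr => ?_, ?_⟩
    · rcases Finset.mem_insert.1 hr with rfl | h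
      · exact le_rfl
      · exact (hmax r h).le
    obtain ⟨m, h1, h2, h3⟩ := hQ.exists_median (f s) (f τ) (f a)
    have hsub : (⋃ r ∈ insert s (insert a T), path (f s) (f r)) ⊆
        (⋃ r ∈ insert s T, path (f s) (f r)) ∪ path m (f a) := by
      intro w hw
      simp only [mem_iUnion, exists_prop] at hw
      obtain ⟨r, hr, hw⟩ := hw
      by_cases hra : r = a
      · subst hra
        rcases hQ.mem_path_or_mem_path h3 hw with h | h
        · exact Or.inl (mem_biUnion (x := τ) hτ (mem_path_trans h1 h))
        · exact Or.inr h
      · refine Or.inl (mem_biUnion (x := r) ?_ hw)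
        simp only [Finset.mem_insert, hra, false_or] at hr
        simpa using hr
    have h4 := (measureReal_mono (μ := lengthMeasure Q) hsub (measure_ne_top _ _)).trans
      (measureReal_union_le _ _)
    rw [hQ.real_path] at h4
    have h5 := hf.dist_le_mul τ a
    rw [Real.dist_eq, abs_of_nonpos (by linarith), NNReal.coe_one, one_mul] at h5
    rw [mem_path] at h1 h2 h3
    rw [dist_comm m (f τ)] at h1
    linarith

/-- A curve of speed at most one passes twice through almost every point it covers outside
the path from its start to its end. -/
theorem IsTreeNetwork.two_mul_length_image_le (hQ : IsTreeNetwork Q) {f : ℝ → Q}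
    (hf : LipschitzWith 1 f) {s t : ℝ} (hst : s ≤ t) :
    2 * (lengthMeasure Q).real (f '' Icc s t) ≤ t - s + dist (f s) (f t) := by
  have := hQ.isFiniteMeasure
  obtain ⟨F, hF, h⟩ := hQ.exists_finite_ends
  have hcpt : IsCompact (f '' Icc s t) := isCompact_Icc.image hf.continuous
  -- The image is the hull of its start and, for each `a ∈ F`, its farthest point towards `a`.
  have far : ∀ a : Q, ∃ r ∈ Icc s t, ∀ q ∈ f '' Icc s t, q ∈ path (f s) a →
      q ∈ path (f s) (f r) := by
    intro a
    obtain ⟨m, ⟨⟨r, hr, hrm⟩, hm2⟩, hmax⟩ :=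
      (hcpt.inter_right (isClosed_path (f s) a)).exists_isMaxOn
      ⟨f s, mem_image_of_mem f (left_mem_Icc.2 hst), left_mem_path _ _⟩
      (f := fun w => dist (f s) w) (by fun_prop)
    refine ⟨r, hr, fun q hq hqa => ?_⟩
    rw [hrm]
    exact hQ.mem_path_of_dist_le hqa hm2
      (hmax (show q ∈ f '' Icc s t ∩ path (f s) a from ⟨hq, hqa⟩))
  choose r hr hfar using far
  have hcov : f '' Icc s t ⊆ ⋃ x ∈ insert s (hF.toFinset.image r), path (f s) (f x) := by
    intro q hq
    obtain ⟨a, ha, hqa⟩ := h (f s) q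
    refine mem_biUnion (x := r a) ?_ (hfar a q hq hqa)
    simp only [Finset.coe_insert, Finset.coe_image, Finite.coe_toFinset]
    exact Or.inr (mem_image_of_mem r ha)
  have hmem : ∀ x ∈ hF.toFinset.image r, x ∈ Icc s t := by
    intro x hx
    obtain ⟨a, -, rfl⟩ := Finset.mem_image.1 hx
    exact hr a
  obtain ⟨τ, hτ, -, hle⟩ := hQ.two_mul_length_hull_le hf s _ fun x hx => (hmem x hx).1
  have hτ' : τ ∈ Icc s t := by
    rcases Finset.mem_insert.1 hτ with rfl | h
    · exact left_mem_Icc.2 hst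
    · exact hmem τ h
  have h1 := measureReal_mono (μ := lengthMeasure Q) hcov (measure_ne_top _ _)
  have h2 := hf.dist_le_mul t τ
  rw [Real.dist_eq, abs_of_nonneg (by linarith [hτ'.2]), NNReal.coe_one, one_mul] at h2
  linarith [dist_triangle (f s) (f t) (f τ)]

end

section

/-! ### Searches as curves and their search times -/

/-- A search as a curve on the real line, constant on negative times. -/
def Search.curve {O : Q} (S : Search O) (t : ℝ) : Q := S.toFun t.toNNReal

theorem Search.lipschitzWith_curve {O : Q} (S : Search O) : LipschitzWith 1 S.curve := by
  have key : ∀ s t : ℝ, s ≤ t → dist (S.curve s) (S.curve t) ≤ dist s t := by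
    intro s t hst
    have h1 := S.dist_le _ _ (Real.toNNReal_le_toNNReal hst)
    refine h1.trans ?_
    rw [Real.dist_eq, abs_of_nonpos (by linarith), Real.coe_toNNReal', Real.coe_toNNReal']
    rcases max_cases t 0 with h | h <;> rcases max_cases s 0 with h' | h' <;> linarith
  refine LipschitzWith.mk_one fun s t => ?_
  rcases le_total s t with h | h
  · exact key s t h
  · rw [dist_comm, dist_comm s]
    exact key t s h

theorem Search.curve_zero {O : Q} (S : Search O) : S.curve 0 = O := by
  simp [Search.curve, S.start]

theorem Search.curve_coe {O : Q} (S : Search O) (t : ℝ≥0) : S.curve t = S.toFun t := by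
  simp [Search.curve]

theorem Search.image_curve {O : Q} (S : Search O) (t : ℝ≥0) :
    S.curve '' Icc 0 (t : ℝ) = S.toFun '' Icc 0 t := by
  ext x
  constructor
  · rintro ⟨r, hr, rfl⟩
    exact ⟨r.toNNReal, ⟨zero_le, Real.toNNReal_le_iff_le_coe.2 hr.2⟩, rfl⟩
  · rintro ⟨r, hr, rfl⟩
    exact ⟨r, ⟨r.2, hr.2⟩, S.curve_coe r⟩

/-- The search that follows a curve of speed at most one. -/
def Search.ofCurve {O : Q} (f : ℝ → Q) (hf : LipschitzWith 1 f) (h0 : f 0 = O) : Search O where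
  toFun t := f t
  start := h0
  dist_le s t hst := by
    have hst' : (s : ℝ) ≤ t := hst
    refine (hf.dist_le_mul _ _).trans ?_
    rw [Real.dist_eq, abs_of_nonpos (by linarith), NNReal.coe_one]
    linarith

theorem Search.curve_ofCurve {O : Q} {f : ℝ → Q} (hf : LipschitzWith 1 f) (h0 : f 0 = O) {t : ℝ}
    (ht : 0 ≤ t) : (Search.ofCurve f hf h0).curve t = f t := by
  simp [Search.curve, Search.ofCurve, ht]

theorem Search.image_curve_ofCurve {O : Q} {f : ℝ → Q} (hf : LipschitzWith 1 f) (h0 : f 0 = O)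
    (t : ℝ) : (Search.ofCurve f hf h0).curve '' Icc 0 t = f '' Icc 0 t :=
  image_congr fun _ hs => Search.curve_ofCurve hf h0 hs.1

theorem Search.isClosed_image {O : Q} (S : Search O) (s t : ℝ) : IsClosed (S.curve '' Icc s t) :=
  (isCompact_Icc.image S.lipschitzWith_curve.continuous).isClosed

theorem searchTime_le_iff {O : Q} (S : Search O) (x : Q) (t : ℝ≥0) :
    searchTime S x ≤ t ↔ x ∈ S.curve '' Icc 0 (t : ℝ) := by
  constructor
  · intro h
    by_contra hx
    obtain ⟨ε, hε, hball⟩ := Metric.isOpen_iff.1 (S.isClosed_image 0 t).isOpen_compl x hx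
    have hlow : ((t + ε.toNNReal : ℝ≥0) : ℝ≥0∞) ≤ searchTime S x := by
      refine le_iInf₂ fun r hr => ?_
      rw [ENNReal.coe_le_coe, ← NNReal.coe_le_coe, NNReal.coe_add, Real.coe_toNNReal _ hε.le]
      by_contra! hlt
      rcases le_total r t with h1 | h1
      · exact hx ⟨r, ⟨r.2, h1⟩, (S.curve_coe r).trans hr⟩
      · have h2 := S.dist_le t r h1
        have h3 : S.toFun t ∈ Metric.ball x ε := by
          rw [Metric.mem_ball, ← hr]
          linarith
        exact hball h3 ⟨t, ⟨t.coe_nonneg, le_rfl⟩, S.curve_coe t⟩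
    have h3 := ENNReal.coe_le_coe.1 (hlow.trans h)
    rw [← NNReal.coe_le_coe, NNReal.coe_add, Real.coe_toNNReal _ hε.le] at h3
    linarith
  · rintro ⟨r, hr, rfl⟩
    have h1 : searchTime S (S.curve r) ≤ (r.toNNReal : ℝ≥0∞) :=
      iInf₂_le (f := fun (t : ℝ≥0) (_ : S.toFun t = S.curve r) => (t : ℝ≥0∞)) r.toNNReal rfl
    refine h1.trans ?_
    exact ENNReal.coe_le_coe.2 (Real.toNNReal_le_iff_le_coe.2 hr.2)

theorem curve_of_searchTime_eq {O : Q} {S : Search O} {x : Q} {t : ℝ≥0} (h : searchTime S x = t) :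
    S.curve t = x := by
  obtain ⟨r, hr, hrx⟩ := (searchTime_le_iff S x t).1 h.le
  lift r to ℝ≥0 using hr.1
  have h1 := (searchTime_le_iff S x r).2 ⟨r, ⟨r.coe_nonneg, le_rfl⟩, hrx⟩
  rw [h, ENNReal.coe_le_coe] at h1
  rwa [le_antisymm (NNReal.coe_le_coe.1 hr.2) h1] at hrx

theorem setOf_searchTime_le {O : Q} {S : Search O} {x : Q} {t : ℝ≥0} (h : searchTime S x = t) :
    {y | searchTime S y ≤ searchTime S x} = S.curve '' Icc 0 (t : ℝ) := by
  ext y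
  rw [mem_ofPred_eq, h, searchTime_le_iff]

/-! ### The expected search time -/

theorem union_setOf_le_comp {α : Type*} {T : α → ℝ≥0∞} :
    {p : α × α | T p.1 ≤ T p.2} ∪ {p : α × α | T p.2 ≤ T p.1} = univ :=
  eq_univ_of_forall fun p => le_total (T p.1) (T p.2)

section

variable {α : Type*} [MeasurableSpace α] {ν : Measure α} [IsFiniteMeasure ν] {T : α → ℝ≥0∞}

theorem measurableSet_le_comp (hT : Measurable T) :
    MeasurableSet {p : α × α | T p.2 ≤ T p.1} :=
  measurableSet_le (hT.comp measurable_snd) (hT.comp measurable_fst)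

theorem prod_setOf_le_comp_swap (hT : Measurable T) :
    (ν.prod ν) {p : α × α | T p.1 ≤ T p.2} = (ν.prod ν) {p : α × α | T p.2 ≤ T p.1} :=
  (Measure.measurePreserving_swap (μ := ν) (ν := ν)).measure_preimage
    (measurableSet_le_comp hT).nullMeasurableSet

theorem lintegral_setOf_le (hT : Measurable T) :
    ∫⁻ x, ν {y | T y ≤ T x} ∂ν = (ν.prod ν) {p : α × α | T p.2 ≤ T p.1} :=
  (Measure.prod_apply (measurableSet_le_comp hT)).symm

/-- On average, at least half of the points are no later than a given point. -/
theorem sq_measure_univ_le (hT : Measurable T) :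
    ν univ * ν univ ≤ 2 * ∫⁻ x, ν {y | T y ≤ T x} ∂ν := by
  rw [lintegral_setOf_le hT, ← Measure.prod_prod, univ_prod_univ,
    ← union_setOf_le_comp (T := T), two_mul]
  exact (measure_union_le _ _).trans_eq (by rw [prod_setOf_le_comp_swap hT])

theorem two_mul_lintegral_setOf_le [NullSingletonClass ν] (hT : Measurable T)
    (hinj : Function.Injective T) : 2 * ∫⁻ x, ν {y | T y ≤ T x} ∂ν = ν univ * ν univ := by
  rw [lintegral_setOf_le hT, ← Measure.prod_prod, univ_prod_univ,
    ← union_setOf_le_comp (T := T), two_mul]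
  nth_rewrite 1 [← prod_setOf_le_comp_swap hT]
  rw [← measure_union_add_inter _ (measurableSet_le_comp hT)]
  have hdiag : {p : α × α | T p.1 ≤ T p.2} ∩ {p : α × α | T p.2 ≤ T p.1} = {p | p.1 = p.2} := by
    ext p
    exact ⟨fun h => hinj (le_antisymm h.1 h.2), fun h => by simp [show p.1 = p.2 from h]⟩
  have hmeas : MeasurableSet {p : α × α | p.1 = p.2} :=
    hdiag ▸ (measurableSet_le (hT.comp measurable_fst) (hT.comp measurable_snd)).inter
      (measurableSet_le_comp hT)
  rw [hdiag, Measure.prod_apply hmeas]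
  have : ∀ x : α, Prod.mk x ⁻¹' {p : α × α | p.1 = p.2} = {x} := fun x => by
    ext y
    simp [eq_comm]
  simp [this]

end

variable [MeasurableSpace Q] [BorelSpace Q]

theorem measurable_searchTime {O : Q} (S : Search O) : Measurable (searchTime S) := by
  refine measurable_of_Iic fun c => ?_
  induction c with
  | top => simp
  | coe t =>
    have : searchTime S ⁻¹' Iic (t : ℝ≥0∞) = S.curve '' Icc 0 (t : ℝ) := by
      ext y
      exact searchTime_le_iff S y t
    rw [this]
    exact (S.isClosed_image _ _).measurableSet

theorem IsTreeNetwork.isFiniteMeasure_uniform [Nontrivial Q] (hQ : IsTreeNetwork Q) :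
    IsFiniteMeasure (uniform Q) := by
  have := hQ.isFiniteMeasure
  have hpos := hQ.lengthMeasure_pos isOpen_univ univ_nonempty
  refine ⟨?_⟩
  rw [uniform, Measure.smul_apply, smul_eq_mul,
    ENNReal.inv_mul_cancel hpos.ne' (measure_ne_top _ _)]
  exact ENNReal.one_lt_top

theorem IsTreeNetwork.integrable_dist [Nontrivial Q] (hQ : IsTreeNetwork Q) (x : Q) :
    Integrable (fun y => dist x y) (uniform Q) := by
  have := hQ.compactSpace
  have := hQ.isFiniteMeasure_uniform
  exact Continuous.integrable_of_hasCompactSupport (by fun_prop)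
    (HasCompactSupport.of_compactSpace _)

theorem IsTreeNetwork.ofReal_meanDist [Nontrivial Q] (hQ : IsTreeNetwork Q) (x : Q) :
    ENNReal.ofReal (meanDist (uniform Q) x) = ∫⁻ y, ENNReal.ofReal (dist x y) ∂uniform Q :=
  ofReal_integral_eq_lintegral_ofReal (hQ.integrable_dist x)
    (Filter.Eventually.of_forall fun _ => dist_nonneg)

theorem IsTreeNetwork.ofReal_totalLength (hQ : IsTreeNetwork Q) :
    ENNReal.ofReal (totalLength Q) = lengthMeasure Q univ := by
  have := hQ.isFiniteMeasure
  exact ENNReal.ofReal_toReal (measure_ne_top _ _)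

theorem IsTreeNetwork.expectedTime_add_meanDist [Nontrivial Q] (hQ : IsTreeNetwork Q) {O : Q}
    (S : Search O) : expectedTime S (uniform Q) + ENNReal.ofReal (meanDist (uniform Q) O) =
      (lengthMeasure Q univ)⁻¹ *
        ∫⁻ x, searchTime S x + ENNReal.ofReal (dist O x) ∂lengthMeasure Q := by
  rw [hQ.ofReal_meanDist, expectedTime, ← lintegral_add_left (measurable_searchTime S), uniform,
    lintegral_smul_measure, smul_eq_mul]

theorem IsTreeNetwork.inv_mul_sq_measure_univ [Nontrivial Q] (hQ : IsTreeNetwork Q) :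
    (lengthMeasure Q univ)⁻¹ * (lengthMeasure Q univ * lengthMeasure Q univ) =
      ENNReal.ofReal (totalLength Q) := by
  have := hQ.isFiniteMeasure
  have hpos := hQ.lengthMeasure_pos isOpen_univ univ_nonempty
  rw [← mul_assoc, ENNReal.inv_mul_cancel hpos.ne' (measure_ne_top _ _), one_mul,
    hQ.ofReal_totalLength]

/-- When `x` is found, twice the length of the part searched so far is at most the sum of the time
and the distance of `x` from the root. For an `x` that is never found this is trivial. -/
theorem IsTreeNetwork.two_mul_searched_le (hQ : IsTreeNetwork Q) {O : Q} (S : Search O) (x : Q) :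
    2 * lengthMeasure Q {y | searchTime S y ≤ searchTime S x} ≤
      searchTime S x + ENNReal.ofReal (dist O x) := by
  have := hQ.isFiniteMeasure
  rcases eq_or_ne (searchTime S x) ⊤ with h | h
  · simp [h]
  · obtain ⟨t, ht⟩ : ∃ t : ℝ≥0, (t : ℝ≥0∞) = searchTime S x := CanLift.prf _ h
    rw [setOf_searchTime_le ht.symm, ← ht]
    have h1 := hQ.two_mul_length_image_le S.lipschitzWith_curve t.coe_nonneg
    rw [S.curve_zero, curve_of_searchTime_eq ht.symm, sub_zero] at h1
    rw [← ofReal_measureReal (measure_ne_top _ _), ← ENNReal.ofReal_ofNat,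
      ← ENNReal.ofReal_mul (by norm_num), ← ENNReal.ofReal_coe_nnreal,
      ← ENNReal.ofReal_add t.coe_nonneg dist_nonneg]
    exact ENNReal.ofReal_le_ofReal h1

theorem IsTreeNetwork.totalLength_le [Nontrivial Q] (hQ : IsTreeNetwork Q) {O : Q} (S : Search O) :
    ENNReal.ofReal (totalLength Q) ≤
      expectedTime S (uniform Q) + ENNReal.ofReal (meanDist (uniform Q) O) := by
  have := hQ.isFiniteMeasure
  rw [hQ.expectedTime_add_meanDist, ← hQ.inv_mul_sq_measure_univ]
  gcongr
  refine (sq_measure_univ_le (measurable_searchTime S)).trans ?_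
  rw [← lintegral_const_mul' _ _ (by norm_num)]
  exact lintegral_mono fun x => hQ.two_mul_searched_le S x

/-- A closed curve that covers the network in time at most twice the total length meets the lower
bound for the expected search time. The reason is that the parts before and after
reaching `x` both contain the path from the root to `x`, and both obey the lower bound. -/
theorem IsTreeNetwork.expectedTime_of_tour [Nontrivial Q] (hQ : IsTreeNetwork Q) {O : Q}
    (S : Search O) {M : ℝ} (hM0 : 0 ≤ M) (hM : M ≤ 2 * totalLength Q) (hend : S.curve M = O)
    (hcov : S.curve '' Icc 0 M = univ) :
    expectedTime S (uniform Q) + ENNReal.ofReal (meanDist (uniform Q) O) =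
      ENNReal.ofReal (totalLength Q) := by
  have := hQ.isFiniteMeasure
  lift M to ℝ≥0 using hM0
  have hfin : ∀ x, ∃ t : ℝ≥0, searchTime S x = t ∧ (t : ℝ) ≤ M := by
    intro x
    have h := (searchTime_le_iff S x M).2 (hcov ▸ mem_univ x)
    obtain ⟨t, ht⟩ : ∃ t : ℝ≥0, (t : ℝ≥0∞) = searchTime S x :=
      CanLift.prf _ (h.trans_lt ENNReal.coe_lt_top).ne
    rw [← ht, ENNReal.coe_le_coe] at h
    exact ⟨t, ht.symm, h⟩
  have hinj : Function.Injective (searchTime S) := by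
    intro x y hxy
    obtain ⟨t, ht, -⟩ := hfin x
    exact (curve_of_searchTime_eq ht).symm.trans (curve_of_searchTime_eq (hxy.symm.trans ht))
  refine le_antisymm ?_ (hQ.totalLength_le S)
  rw [hQ.expectedTime_add_meanDist, ← hQ.inv_mul_sq_measure_univ]
  gcongr
  rw [← two_mul_lintegral_setOf_le (measurable_searchTime S) hinj,
    ← lintegral_const_mul' _ _ (by norm_num)]
  refine lintegral_mono fun x => ?_
  obtain ⟨t, ht, htM⟩ := hfin x
  have hx := curve_of_searchTime_eq ht
  simp only
  rw [setOf_searchTime_le ht, ht, ← ofReal_measureReal (measure_ne_top _ _), ← ENNReal.ofReal_ofNat,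
    ← ENNReal.ofReal_mul (by norm_num), ← ENNReal.ofReal_coe_nnreal,
    ← ENNReal.ofReal_add t.coe_nonneg dist_nonneg]
  refine ENNReal.ofReal_le_ofReal ?_
  have h1 := hQ.two_mul_length_image_le S.lipschitzWith_curve htM
  rw [hend, hx, dist_comm] at h1
  have h2 := measureReal_union_add_inter (μ := lengthMeasure Q) (s := S.curve '' Icc 0 (t : ℝ))
    (S.isClosed_image t M).measurableSet
  rw [← image_union, Icc_union_Icc_eq_Icc t.coe_nonneg htM, hcov, real_univ_eq_totalLength] at h2
  have hsub : path O x ⊆ S.curve '' Icc 0 (t : ℝ) ∩ S.curve '' Icc (t : ℝ) M := by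
    have hc := S.lipschitzWith_curve.continuous
    refine subset_inter ?_ ?_
    · exact hQ.path_subset_of_isPreconnected (isPreconnected_Icc.image _ hc.continuousOn)
        ⟨0, left_mem_Icc.2 t.coe_nonneg, S.curve_zero⟩ ⟨t, right_mem_Icc.2 t.coe_nonneg, hx⟩
    · exact hQ.path_subset_of_isPreconnected (isPreconnected_Icc.image _ hc.continuousOn)
        ⟨M, right_mem_Icc.2 htM, hend⟩ ⟨t, left_mem_Icc.2 htM, hx⟩
  have h3 := measureReal_mono (μ := lengthMeasure Q) hsub
  rw [hQ.real_path] at h3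
  linarith

/-- A search that meets the lower bound covers the network, and from its position at that time
it can return to the root within twice the total length. -/
theorem IsTreeNetwork.exists_cover_time [Nontrivial Q] (hQ : IsTreeNetwork Q) {O : Q}
    (S : Search O) (h : expectedTime S (uniform Q) + ENNReal.ofReal (meanDist (uniform Q) O) ≤
      ENNReal.ofReal (totalLength Q)) :
    ∃ M : ℝ, 0 ≤ M ∧ S.curve '' Icc 0 M = univ ∧ M + dist O (S.curve M) ≤ 2 * totalLength Q := by
  have := hQ.isFiniteMeasure
  have hpos := hQ.lengthMeasure_pos isOpen_univ univ_nonempty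
  have hae : (fun x => 2 * lengthMeasure Q {y | searchTime S y ≤ searchTime S x})
      =ᵐ[lengthMeasure Q] fun x => searchTime S x + ENNReal.ofReal (dist O x) := by
    rw [hQ.expectedTime_add_meanDist, ← hQ.inv_mul_sq_measure_univ,
      ENNReal.mul_le_mul_iff_right (ENNReal.inv_ne_zero.2 (measure_ne_top _ _))
        (ENNReal.inv_ne_top.2 hpos.ne')] at h
    refine ae_eq_of_ae_le_of_lintegral_le (.of_forall fun x => hQ.two_mul_searched_le S x) ?_ ?_ ?_
    · refine ne_top_of_le_ne_top ?_
        ((lintegral_mono fun x => hQ.two_mul_searched_le S x).trans h)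
      finiteness
    · exact ((measurable_searchTime S).add (by fun_prop)).aemeasurable
    · rw [lintegral_const_mul' _ _ (by norm_num)]
      exact h.trans (sq_measure_univ_le (measurable_searchTime S))
  -- Points where equality holds are dense, so one is found after any time before covering.
  have key : ∀ s : ℝ, 0 ≤ s → S.curve '' Icc 0 s ≠ univ →
      ∃ t, s < t ∧ S.curve t ∉ S.curve '' Ico 0 t ∧ t + dist O (S.curve t) ≤ 2 * totalLength Q := by
    intro s hs hne
    have hU := hQ.lengthMeasure_pos (S.isClosed_image 0 s).isOpen_compl
      (nonempty_compl.2 hne)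
    obtain ⟨x, hxU, hx⟩ : ∃ x ∈ (S.curve '' Icc 0 s)ᶜ,
        2 * lengthMeasure Q {y | searchTime S y ≤ searchTime S x} =
          searchTime S x + ENNReal.ofReal (dist O x) := by
      by_contra! hc
      exact hU.ne' (measure_mono_null hc (ae_iff.1 hae))
    have hle : searchTime S x + ENNReal.ofReal (dist O x) ≤ 2 * ENNReal.ofReal (totalLength Q) := by
      rw [← hx, hQ.ofReal_totalLength]
      gcongr
      exact subset_univ _
    have htop : searchTime S x ≠ ⊤ := by
      intro htop
      rw [htop, top_add, top_le_iff] at hle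
      exact (by finiteness : 2 * ENNReal.ofReal (totalLength Q) ≠ ⊤) hle
    obtain ⟨t, ht⟩ : ∃ t : ℝ≥0, (t : ℝ≥0∞) = searchTime S x := CanLift.prf _ htop
    have hxt := curve_of_searchTime_eq ht.symm
    refine ⟨t, ?_, ?_, ?_⟩
    · by_contra! hts
      exact hxU ⟨t, ⟨t.coe_nonneg, hts⟩, hxt⟩
    · rintro ⟨r, hr, hrt⟩
      lift r to ℝ≥0 using hr.1
      have h1 := (searchTime_le_iff S x r).2 ⟨r, ⟨r.coe_nonneg, le_rfl⟩, hrt.trans hxt⟩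
      rw [← ht, ENNReal.coe_le_coe] at h1
      exact absurd hr.2 (not_lt.2 (NNReal.coe_le_coe.2 h1))
    · rw [← ht, ← ENNReal.ofReal_ofNat, ← ENNReal.ofReal_mul (by norm_num),
        ← ENNReal.ofReal_coe_nnreal, ← ENNReal.ofReal_add t.coe_nonneg dist_nonneg,
        ENNReal.ofReal_le_ofReal_iff (by have := hQ.totalLength_pos; positivity)] at hle
      rwa [hxt]
  set B : Set ℝ := {s | 0 ≤ s ∧ S.curve '' Icc 0 s ≠ univ} with hB
  have hB0 : (0 : ℝ) ∈ B := by
    refine ⟨le_rfl, fun h => ?_⟩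
    rw [Icc_self, image_singleton] at h
    obtain ⟨y, hy⟩ := exists_ne (S.curve 0)
    exact hy (h ▸ mem_univ y : y ∈ ({S.curve 0} : Set Q))
  have hBt : ∀ s ∈ B, ∃ t, s < t ∧ (∀ r ∈ Ico 0 t, r ∈ B) ∧
      t + dist O (S.curve t) ≤ 2 * totalLength Q := by
    intro s hs
    obtain ⟨t, hst, hnew, hle⟩ := key s hs.1 hs.2
    refine ⟨t, hst, fun r hr => ⟨hr.1, fun h => hnew ?_⟩, hle⟩
    obtain ⟨r', hr', h'⟩ := h.symm ▸ mem_univ (S.curve t)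
    exact ⟨r', ⟨hr'.1, hr'.2.trans_lt hr.2⟩, h'⟩
  have hbdd : BddAbove B := ⟨2 * totalLength Q, fun s hs => by
    obtain ⟨t, hst, -, hle⟩ := hBt s hs
    linarith [dist_nonneg (x := O) (y := S.curve t)]⟩
  have htM : ∀ s ∈ B, ∃ t, s < t ∧ t ≤ sSup B ∧ t + dist O (S.curve t) ≤ 2 * totalLength Q := by
    intro s hs
    obtain ⟨t, hst, hIco, hle⟩ := hBt s hs
    refine ⟨t, hst, le_of_forall_lt_imp_le_of_dense fun r hr => ?_, hle⟩
    rcases le_or_gt 0 r with h0 | h0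
    · exact le_csSup hbdd (hIco r ⟨h0, hr⟩)
    · exact h0.le.trans (le_csSup hbdd hB0)
  have hM0 : 0 ≤ sSup B := le_csSup hbdd hB0
  refine ⟨sSup B, hM0, ?_, ?_⟩
  · by_contra hne
    obtain ⟨t, h1, h2, -⟩ := htM _ ⟨hM0, hne⟩
    exact absurd h2 (not_le.2 h1)
  · refine le_of_forall_pos_le_add fun ε hε => ?_
    obtain ⟨s, hs, hsε⟩ := exists_lt_of_lt_csSup ⟨0, hB0⟩ (show sSup B - ε / 2 < sSup B by linarith)
    obtain ⟨t, h1, h2, h3⟩ := htM s hs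
    have h4 := S.lipschitzWith_curve.dist_le_mul t (sSup B)
    rw [Real.dist_eq, abs_of_nonpos (by linarith), NNReal.coe_one] at h4
    linarith [dist_triangle O (S.curve t) (S.curve (sSup B))]

end

section

/-! ### Closed tours -/

/-- The curve that follows `f` until time `τ` and `g` afterwards. -/
noncomputable def glue {X : Type*} (τ : ℝ) (f g : ℝ → X) (t : ℝ) : X := if t ≤ τ then f t else g t

theorem glue_of_le {X : Type*} {τ t : ℝ} (f g : ℝ → X) (h : t ≤ τ) : glue τ f g t = f t := if_pos h

theorem glue_of_ge {X : Type*} {τ t : ℝ} {f g : ℝ → X} (hfg : f τ = g τ) (h : τ ≤ t) :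
    glue τ f g t = g t := by
  rcases h.eq_or_lt with rfl | h
  · rw [glue_of_le f g le_rfl, hfg]
  · exact if_neg (not_le.2 h)

theorem lipschitzWith_glue {τ : ℝ} {f g : ℝ → Q} (hf : LipschitzWith 1 f) (hg : LipschitzWith 1 g)
    (hfg : f τ = g τ) : LipschitzWith 1 (glue τ f g) := by
  have key : ∀ s t : ℝ, s ≤ t → dist (glue τ f g s) (glue τ f g t) ≤ dist s t := by
    intro s t hst
    have hf' := fun s t => hf.dist_le_mul s t
    have hg' := fun s t => hg.dist_le_mul s t
    simp only [NNReal.coe_one, one_mul] at hf' hg'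
    rcases le_total t τ with ht | ht
    · rw [glue_of_le f g ht, glue_of_le f g (hst.trans ht)]
      exact hf' s t
    rcases le_total τ s with hs | hs
    · rw [glue_of_ge hfg ht, glue_of_ge hfg hs]
      exact hg' s t
    · rw [glue_of_ge hfg ht, glue_of_le f g hs]
      have h1 := hf' s τ
      have h2 := hg' τ t
      rw [hfg] at h1
      have h3 := dist_triangle (f s) (g τ) (g t)
      rw [Real.dist_eq, abs_of_nonpos (by linarith)] at *
      linarith
  refine LipschitzWith.mk_one fun s t => ?_
  rcases le_total s t with h | h
  · exact key s t h
  · rw [dist_comm, dist_comm s]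
    exact key t s h

/-- A tour of duration `M`: a curve of speed at most one that starts at `O`, is back at `O` at time
`M`, and has covered the whole space by then. What it does outside `[0, M]` does not matter. -/
structure IsTour (O : Q) (f : ℝ → Q) (M : ℝ) : Prop where
  lipschitz : LipschitzWith 1 f
  nonneg : 0 ≤ M
  start : f 0 = O
  finish : f M = O
  cover : f '' Icc 0 M = univ

/-- A curve that has covered the space becomes a tour by going straight back to the root. -/
theorem IsTreeNetwork.exists_isTour_of_cover (hQ : IsTreeNetwork Q) {O : Q} {f : ℝ → Q} {M : ℝ}
    (hf : LipschitzWith 1 f) (h0 : f 0 = O) (hM : 0 ≤ M) (hcov : f '' Icc 0 M = univ) :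
    ∃ g, IsTour O g (M + dist O (f M)) ∧ ∀ t ≤ M, g t = f t := by
  obtain ⟨γ, hL, z0, z1, -⟩ := hQ.exists_geodesic (f M) O
  have hfg : f M = γ (M - M) := by rw [sub_self, z0 0 le_rfl]
  have hle : M ≤ M + dist O (f M) := le_add_of_nonneg_right dist_nonneg
  refine ⟨glue M f fun t => γ (t - M), ⟨lipschitzWith_glue hf ?_ hfg, hM.trans hle, ?_, ?_, ?_⟩,
    fun t ht => glue_of_le _ _ ht⟩
  · refine LipschitzWith.mk_one fun s t => (hL.dist_le_mul _ _).trans ?_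
    simp
  · rw [glue_of_le _ _ hM, h0]
  · rw [glue_of_ge hfg hle]
    exact z1 _ (by rw [add_sub_cancel_left, dist_comm])
  · refine eq_univ_of_univ_subset ?_
    rw [← hcov]
    rintro _ ⟨t, ht, rfl⟩
    exact ⟨t, ⟨ht.1, ht.2.trans hle⟩, glue_of_le _ _ ht.2⟩

variable [MeasurableSpace Q] [BorelSpace Q]

/-- Closed curves through finitely many given points that take only twice the length of the part
they cover. They are built by inserting, for each new point `p`, a detour to `p` and
back at the point of the curve nearest to `p`. -/
theorem IsTreeNetwork.exists_closed_curve (hQ : IsTreeNetwork Q) (O : Q) {G : Set Q}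
    (hG : G.Finite) : ∃ (f : ℝ → Q) (M : ℝ), LipschitzWith 1 f ∧ 0 ≤ M ∧ f 0 = O ∧ f M = O ∧
      M ≤ 2 * (lengthMeasure Q).real (f '' Icc 0 M) ∧ G ⊆ f '' Icc 0 M := by
  have := hQ.isFiniteMeasure
  induction G, hG using Set.Finite.induction_on with
  | empty =>
    exact ⟨fun _ => O, 0, LipschitzWith.const' O, le_rfl, rfl, rfl, by positivity, empty_subset _⟩
  | @insert p G _ _ ih =>
    obtain ⟨f, M, hf, hM, h0, h1, hle, hGf⟩ := ih
    have hcpt : IsCompact (f '' Icc 0 M) := isCompact_Icc.image hf.continuous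
    obtain ⟨m, ⟨⟨τ, hτ, hτm⟩, hm2⟩, hmax⟩ :=
      (hcpt.inter_right (isClosed_path O p)).exists_isMaxOn
      ⟨O, ⟨0, left_mem_Icc.2 hM, h0⟩, left_mem_path _ _⟩ (f := fun w => dist O w) (by fun_prop)
    have hinter : f '' Icc 0 M ∩ path m p ⊆ {m} := by
      rintro w ⟨hw1, hw2⟩
      have h3 := mem_path.1 (mem_path_shift' hm2 hw2)
      have h2 : dist O w ≤ dist O m :=
        hmax (show w ∈ f '' Icc 0 M ∩ path O p from ⟨hw1, mem_path_trans' hm2 hw2⟩)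
      exact (dist_eq_zero.1 (by linarith [dist_nonneg (x := m) (y := w)])).symm
    obtain ⟨γ, hL, z0, z1, -, himg, -⟩ := hQ.exists_geodesic m p
    set d := dist m p with hd
    have hd0 : 0 ≤ d := dist_nonneg
    have hdet : LipschitzWith 1 fun t => γ (d - |t - τ - d|) := by
      refine LipschitzWith.mk_one fun s t => (hL.dist_le_mul _ _).trans ?_
      rw [NNReal.coe_one, one_mul, Real.dist_eq, Real.dist_eq]
      refine (le_of_eq ?_).trans ((abs_abs_sub_abs_le_abs_sub (t - τ - d) (s - τ - d)).trans
        (le_of_eq ?_))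
      · congr 1; ring
      · rw [abs_sub_comm s t]; congr 1; ring
    have hshift : LipschitzWith 1 fun t => f (t - 2 * d) :=
      LipschitzWith.mk_one fun s t => (hf.dist_le_mul _ _).trans (by simp)
    have e1 : (fun t => γ (d - |t - τ - d|)) (τ + 2 * d) =
        (fun t => f (t - 2 * d)) (τ + 2 * d) := by
      have h1 : τ + 2 * d - τ - d = d := by ring
      have h2 : τ + 2 * d - 2 * d = τ := by ring
      simp only [h1, h2]
      rw [abs_of_nonneg hd0, sub_self, z0 0 le_rfl, hτm]
    have e2 : f τ = glue (τ + 2 * d) (fun t => γ (d - |t - τ - d|)) (fun t => f (t - 2 * d)) τ := by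
      rw [glue_of_le _ _ (by linarith)]
      simp only [sub_self, zero_sub, abs_neg]
      rw [abs_of_nonneg hd0, sub_self, z0 0 le_rfl, hτm]
    set g := glue τ f (glue (τ + 2 * d) (fun t => γ (d - |t - τ - d|)) (fun t => f (t - 2 * d)))
      with hg
    have hsub : f '' Icc 0 M ∪ path m p ⊆ g '' Icc 0 (M + 2 * d) := by
      rintro w (⟨t, ht, rfl⟩ | hw)
      · rcases le_total t τ with h | h
        · exact ⟨t, ⟨ht.1, by linarith [ht.2]⟩, glue_of_le _ _ h⟩
        · refine ⟨t + 2 * d, ⟨by linarith [ht.1], by linarith [ht.2]⟩, ?_⟩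
          rw [hg, glue_of_ge e2 (by linarith), glue_of_ge e1 (by linarith), add_sub_cancel_right]
      · rw [← himg] at hw
        obtain ⟨r, hr, rfl⟩ := hw
        refine ⟨τ + r, ⟨by linarith [hr.1, hτ.1], by linarith [hr.2, hτ.2]⟩, ?_⟩
        rw [hg, glue_of_ge e2 (by linarith [hr.1]), glue_of_le _ _ (by linarith [hr.2])]
        have : τ + r - τ - d = r - d := by ring
        simp only [this]
        rw [abs_of_nonpos (by linarith [hr.2])]
        congr 1; ring
    refine ⟨g, M + 2 * d, lipschitzWith_glue hf (lipschitzWith_glue hdet hshift e1) e2,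
      by linarith, ?_, ?_, ?_, ?_⟩
    · rw [hg, glue_of_le _ _ hτ.1, h0]
    · rw [hg, glue_of_ge e2 (by linarith [hτ.2]), glue_of_ge e1 (by linarith [hτ.2]),
        add_sub_cancel_right, h1]
    · have h2 := measureReal_union_add_inter (μ := lengthMeasure Q) (s := f '' Icc 0 M)
        (isClosed_path m p).measurableSet
      have h3 : (lengthMeasure Q).real (f '' Icc 0 M ∩ path m p) = 0 := by
        rw [Measure.real, measure_mono_null hinter (measure_singleton m), ENNReal.toReal_zero]
      have h4 := measureReal_mono (μ := lengthMeasure Q) hsub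
      rw [hQ.real_path] at h2
      linarith
    · refine insert_subset (hsub (Or.inr (right_mem_path m p))) ?_
      exact hGf.trans (subset_union_left.trans hsub)

theorem IsTreeNetwork.exists_isTour (hQ : IsTreeNetwork Q) (O : Q) :
    ∃ f M, IsTour O f M ∧ M ≤ 2 * totalLength Q := by
  have := hQ.isFiniteMeasure
  obtain ⟨F, hF, hcov⟩ := hQ.exists_finite_ends
  obtain ⟨f, M, hf, hM, h0, h1, hle, hFf⟩ := hQ.exists_closed_curve O hF
  refine ⟨f, M, ⟨hf, hM, h0, h1, eq_univ_of_forall fun q => ?_⟩,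
    hle.trans (mul_le_mul_of_nonneg_left (measureReal_mono (subset_univ _)) zero_le_two)⟩
  obtain ⟨a, ha, hq⟩ := hcov O q
  exact hQ.path_subset_of_isPreconnected (isPreconnected_Icc.image f hf.continuous.continuousOn)
    ⟨0, left_mem_Icc.2 hM, h0⟩ (hFf ha) hq

end

/-! ### Depth-first searches are tours -/

/-- The finite set of arcs, each in both directions. -/
noncomputable def IsTreeNetwork.arcs [Nontrivial Q] (hQ : IsTreeNetwork Q) (O : Q) :
    Finset (Q × Q) :=
  (hQ.finite_setOf_isArc O).toFinset

theorem IsTreeNetwork.mem_arcs [Nontrivial Q] (hQ : IsTreeNetwork Q) {O : Q} {p : Q × Q} :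
    p ∈ hQ.arcs O ↔ IsArc O p.1 p.2 := by
  simp [IsTreeNetwork.arcs]

open Classical in
theorem IsTreeNetwork.totalLength_eq_sum [Nontrivial Q] [MeasurableSpace Q] [BorelSpace Q]
    (hQ : IsTreeNetwork Q) (O : Q) :
    totalLength Q = ∑ p ∈ hQ.arcs O with p.1 ∈ path O p.2, dist p.1 p.2 := by
  have := hQ.isFiniteMeasure
  have hunion : ⋃ p ∈ (hQ.arcs O).filter fun p => p.1 ∈ path O p.2, path p.1 p.2 \ {p.1} =
      univ \ {O} := by
    ext z
    simp only [mem_iUnion, Finset.mem_filter, hQ.mem_arcs, mem_sdiff, mem_singleton_iff, mem_univ,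
      true_and, exists_prop, Prod.exists]
    constructor
    · rintro ⟨a, b, ⟨-, hab⟩, hz, hza⟩ rfl
      exact hza (eq_of_mem_path_of_mem_path (left_mem_path z a) (mem_path_shift' hab hz))
    · intro hz
      obtain ⟨a, b, h1, h2, h3, h4⟩ := hQ.exists_isArc_mem_path hz
      exact ⟨a, b, ⟨h1, h2⟩, h3, h4⟩
  have h1 : (lengthMeasure Q).real (univ \ {O}) = totalLength Q := by
    rw [← real_univ_eq_totalLength, Measure.real, Measure.real,
      measure_sdiff_null (measure_singleton O)]
  rw [← h1, ← hunion, measureReal_biUnion_finset]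
  · refine Finset.sum_congr rfl fun p _ => ?_
    rw [← hQ.real_path p.1 p.2, Measure.real, Measure.real,
      measure_sdiff_null (measure_singleton p.1)]
  · intro p hp q hq hpq
    simp only [Finset.coe_filter, mem_ofPred_eq, hQ.mem_arcs] at hp hq
    refine disjoint_left.2 fun z hz hz' => hpq ?_
    obtain ⟨h1, h2⟩ := hQ.eq_of_mem_arcs hp.1 hq.1 hp.2 hq.2 hz.1 hz'.1 hz.2 hz'.2
    exact Prod.ext h1 h2
  · exact fun p _ => (isClosed_path _ _).measurableSet.diff (measurableSet_singleton _)

theorem IsTreeNetwork.sum_arcs [Nontrivial Q] [MeasurableSpace Q] [BorelSpace Q]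
    (hQ : IsTreeNetwork Q) (O : Q) :
    ∑ p ∈ hQ.arcs O, dist p.1 p.2 = 2 * totalLength Q := by
  classical
  rw [← Finset.sum_filter_add_sum_filter_not (hQ.arcs O) (fun p => p.1 ∈ path O p.2), two_mul]
  have key : ∑ p ∈ hQ.arcs O with p.1 ∉ path O p.2, dist p.1 p.2 =
      ∑ p ∈ hQ.arcs O with p.1 ∈ path O p.2, dist p.1 p.2 := by
    refine Finset.sum_nbij' Prod.swap Prod.swap ?_ ?_ (fun _ _ => rfl) (fun _ _ => rfl)
      (fun p _ => dist_comm _ _)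
    · intro p hp
      simp only [Finset.mem_filter, hQ.mem_arcs, Prod.fst_swap, Prod.snd_swap] at hp ⊢
      exact ⟨hp.1.symm, (hQ.mem_path_root hp.1).resolve_left hp.2⟩
    · intro p hp
      simp only [Finset.mem_filter, hQ.mem_arcs, Prod.fst_swap, Prod.snd_swap] at hp ⊢
      exact ⟨hp.1.symm, hp.1.not_mem_path hp.2⟩
  rw [key, ← hQ.totalLength_eq_sum O]

theorem arrivalTime_mono (v : ℕ → Q) : Monotone (arrivalTime v) := fun _ _ hij =>
  Finset.sum_le_sum_of_subset_of_nonneg (Finset.range_mono hij) fun _ _ _ => dist_nonneg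

theorem arrivalTime_succ (v : ℕ → Q) (i : ℕ) :
    arrivalTime v (i + 1) = arrivalTime v i + dist (v i) (v (i + 1)) :=
  Finset.sum_range_succ _ _

theorem IsDF.exists_isTour [Nontrivial Q] [MeasurableSpace Q] [BorelSpace Q]
    (hQ : IsTreeNetwork Q) {O : Q} {S : Search O} (hS : IsDF S) :
    ∃ M ≤ 2 * totalLength Q, IsTour O S.curve M := by
  obtain ⟨n, v, hv0, hvn, harc, huniq, -, hfol⟩ := hS
  have hnn : ∀ i, 0 ≤ arrivalTime v i := fun i => by
    simpa [arrivalTime] using arrivalTime_mono v i.zero_le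
  have hfol' : ∀ i < n, ∀ t : ℝ, arrivalTime v i ≤ t → t ≤ arrivalTime v (i + 1) →
      S.curve t ∈ path (v i) (v (i + 1)) ∧ dist (v i) (S.curve t) = t - arrivalTime v i := by
    intro i hi t h1 h2
    lift t to ℝ≥0 using (hnn i).trans h1
    rw [S.curve_coe]
    exact hfol i hi t h1 h2
  have hend : ∀ i < n, S.curve (arrivalTime v (i + 1)) = v (i + 1) := by
    intro i hi
    obtain ⟨h1, h2⟩ := hfol' i hi _ (arrivalTime_mono v i.le_succ) le_rfl
    refine hQ.eq_of_dist_eq h1 (right_mem_path _ _) ?_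
    rw [h2, arrivalTime_succ]; ring
  refine ⟨arrivalTime v n, ?_, S.lipschitzWith_curve, hnn n, S.curve_zero, ?_, ?_⟩
  · rw [← hQ.sum_arcs O]
    refine le_of_eq (Finset.sum_nbij (fun i => (v i, v (i + 1))) ?_ ?_ ?_ fun _ _ => rfl)
    · intro i hi
      exact hQ.mem_arcs.2 (harc i (Finset.mem_range.1 hi))
    · intro i hi j hj hij
      simp only [Finset.coe_range, mem_Iio, Prod.mk.injEq] at hi hj hij
      exact (huniq _ _ (harc i hi)).unique ⟨hi, rfl, rfl⟩ ⟨hj, hij.1.symm, hij.2.symm⟩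
    · rintro ⟨a, b⟩ hab
      obtain ⟨i, ⟨hi, h1, h2⟩, -⟩ := huniq a b (hQ.mem_arcs.1 hab)
      exact ⟨i, Finset.mem_coe.2 (Finset.mem_range.2 hi), Prod.ext h1 h2⟩
  · rcases n with _ | n
    · simpa [arrivalTime] using S.curve_zero
    · rw [hend n n.lt_succ_self, hvn]
  · refine eq_univ_of_forall fun z => ?_
    rcases eq_or_ne z O with rfl | hz
    · exact ⟨0, left_mem_Icc.2 (hnn n), S.curve_zero⟩
    obtain ⟨a, b, hab, -, hzab, -⟩ := hQ.exists_isArc_mem_path hz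
    obtain ⟨i, ⟨hi, rfl, rfl⟩, -⟩ := huniq a b hab
    have h1 : arrivalTime v i ≤ arrivalTime v i + dist (v i) z := le_add_of_nonneg_right dist_nonneg
    have h2 : arrivalTime v i + dist (v i) z ≤ arrivalTime v (i + 1) := by
      rw [arrivalTime_succ]
      gcongr
      exact dist_le_of_mem_path hzab
    obtain ⟨h3, h4⟩ := hfol' i hi _ h1 h2
    refine ⟨_, ⟨(hnn i).trans h1, h2.trans (arrivalTime_mono v hi)⟩, hQ.eq_of_dist_eq h3 hzab ?_⟩
    rw [h4, add_sub_cancel_left]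

/-! ### Short tours are depth-first -/

/-- While a curve goes from one end of an arc to the other without visiting the ends in between,
it stays inside the arc. -/
theorem IsTreeNetwork.mem_path_of_mem_Ioo (hQ : IsTreeNetwork Q) {O a b : Q} (h : IsArc O a b)
    {f : ℝ → Q} (hf : Continuous f) {τ σ : ℝ} (hτ : f τ = a) (hσ : f σ = b)
    (ha : ∀ t ∈ Ioo τ σ, f t ≠ a) (hb : ∀ t ∈ Ioo τ σ, f t ≠ b) {t : ℝ} (ht : t ∈ Ioo τ σ) :
    f t ∈ path a b := by
  refine hQ.mem_path_of_isArc h (fun hc => ?_) (fun hc => ?_)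
  · rw [← hσ] at hc
    obtain ⟨r, hr, hra⟩ := hQ.exists_eq_of_mem_path hf ht.2.le hc
    rcases hr.2.eq_or_lt with rfl | hrσ
    · exact h.2.2.1 (hra.symm.trans hσ)
    · exact ha r ⟨ht.1.trans_le hr.1, hrσ⟩ hra
  · rw [← hτ] at hc
    obtain ⟨r, hr, hrb⟩ := hQ.exists_eq_of_mem_path hf ht.1.le hc
    rcases hr.1.eq_or_lt with rfl | hrτ
    · exact h.2.2.1 (hτ.symm.trans hrb)
    · exact hb r ⟨hrτ, hr.2.trans_lt ht.2⟩ hrb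

/-- Every directed arc has a time interval in which a tour traverses it: on the way out, the
traversal that ends with the first visit to the far end; on the way back, the one that begins
with the last visit to the far end. -/
theorem IsTour.exists_traversal (hQ : IsTreeNetwork Q) {O a b : Q} {f : ℝ → Q} {M : ℝ}
    (hf : IsTour O f M) (h : IsArc O a b) :
    ∃ τ σ : ℝ, 0 ≤ τ ∧ σ ≤ M ∧ τ + dist a b ≤ σ ∧ f τ = a ∧ f σ = b ∧
      (∀ t ∈ Ioo τ σ, f t ∈ path a b ∧ f t ≠ a ∧ f t ≠ b) ∧
      (a ∈ path O b → ∀ t ∈ Icc 0 M, f t = b → σ ≤ t) ∧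
      (b ∈ path O a → ∀ t ∈ Icc 0 M, f t = a → t ≤ τ) := by
  have hc := hf.lipschitz.continuous
  have hclosed : ∀ (s t : ℝ) (x : Q), IsCompact (Icc s t ∩ f ⁻¹' {x}) := fun s t x =>
    isCompact_Icc.inter_right (isClosed_singleton.preimage hc)
  have hvisit : ∀ x, (Icc 0 M ∩ f ⁻¹' {x}).Nonempty := fun x => by
    obtain ⟨t, ht, htx⟩ := hf.cover.symm ▸ mem_univ x
    exact ⟨t, ht, htx⟩
  have hlen : ∀ {τ σ : ℝ}, τ ≤ σ → f τ = a → f σ = b → τ + dist a b ≤ σ := by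
    intro τ σ hle h1 h2
    have := hf.lipschitz.dist_le_mul τ σ
    rw [h1, h2, Real.dist_eq, abs_of_nonpos (by linarith), NNReal.coe_one] at this
    linarith
  rcases hQ.mem_path_root h with hab | hba
  · obtain ⟨σ, ⟨hσ, hσb⟩, hmin⟩ := (hclosed 0 M b).exists_isLeast (hvisit b)
    have hσb' : f σ = b := hσb
    obtain ⟨τ, ⟨hτ, hτa⟩, hmax⟩ := (hclosed 0 σ a).exists_isGreatest (by
      rw [← hf.start, ← hσb'] at hab
      obtain ⟨r, hr, hra⟩ := hQ.exists_eq_of_mem_path hc hσ.1 hab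
      exact ⟨r, hr, hra⟩)
    have ha : ∀ t ∈ Ioo τ σ, f t ≠ a := fun t ht hta =>
      absurd (hmax ⟨⟨hτ.1.trans ht.1.le, ht.2.le⟩, hta⟩) (not_le.2 ht.1)
    have hb : ∀ t ∈ Ioo τ σ, f t ≠ b := fun t ht htb =>
      absurd (hmin ⟨⟨hτ.1.trans ht.1.le, ht.2.le.trans hσ.2⟩, htb⟩) (not_le.2 ht.2)
    exact ⟨τ, σ, hτ.1, hσ.2, hlen hτ.2 hτa hσb, hτa, hσb,
      fun t ht => ⟨hQ.mem_path_of_mem_Ioo h hc hτa hσb ha hb ht, ha t ht, hb t ht⟩,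
      fun _ t ht htb => hmin ⟨ht, htb⟩, fun hba => absurd hba (h.not_mem_path hab)⟩
  · obtain ⟨τ, ⟨hτ, hτa⟩, hmax⟩ := (hclosed 0 M a).exists_isGreatest (hvisit a)
    have hτa' : f τ = a := hτa
    obtain ⟨σ, ⟨hσ, hσb⟩, hmin⟩ := (hclosed τ M b).exists_isLeast (by
      rw [← hf.finish, ← hτa', path_comm] at hba
      obtain ⟨r, hr, hrb⟩ := hQ.exists_eq_of_mem_path hc hτ.2 hba
      exact ⟨r, hr, hrb⟩)
    have ha : ∀ t ∈ Ioo τ σ, f t ≠ a := fun t ht hta =>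
      absurd (hmax ⟨⟨hτ.1.trans ht.1.le, ht.2.le.trans hσ.2⟩, hta⟩) (not_le.2 ht.1)
    have hb : ∀ t ∈ Ioo τ σ, f t ≠ b := fun t ht htb =>
      absurd (hmin ⟨⟨ht.1.le, ht.2.le.trans hσ.2⟩, htb⟩) (not_le.2 ht.2)
    exact ⟨τ, σ, hτ.1, hσ.2, hlen hσ.1 hτa hσb, hτa, hσb,
      fun t ht => ⟨hQ.mem_path_of_mem_Ioo h hc hτa hσb ha hb ht, ha t ht, hb t ht⟩,
      fun hab => absurd hba (h.not_mem_path hab), fun _ t ht hta => hmax ⟨ht, hta⟩⟩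

/-- Finitely many disjoint intervals in `[0, M]` whose lengths add up to at least `M` can be
listed in such an order that each begins where the one before it ends. -/
theorem exists_enumeration {ι : Type*} [Fintype ι] [Nonempty ι] {τ σ ℓ : ι → ℝ} {M : ℝ}
    (hℓ : ∀ i, 0 < ℓ i) (hτ : ∀ i, 0 ≤ τ i) (hσ : ∀ i, σ i ≤ M) (hle : ∀ i, τ i + ℓ i ≤ σ i)
    (hdisj : ∀ i j, i ≠ j → Disjoint (Ioo (τ i) (σ i)) (Ioo (τ j) (σ j))) (hM : M ≤ ∑ i, ℓ i) :
    ∃ (n : ℕ) (e : ℕ → ι), 0 < n ∧ (∀ x, ∃ i < n, e i = x) ∧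
      (∀ i < n, ∀ j < n, i < j → τ (e i) < τ (e j)) ∧
      (∀ i < n, τ (e i) = ∑ j ∈ Finset.range i, ℓ (e j)) ∧
      (∀ i < n, σ (e i) = τ (e i) + ℓ (e i)) ∧ M = ∑ j ∈ Finset.range n, ℓ (e j) := by
  have hlt : ∀ i, τ i < σ i := fun i => by linarith [hℓ i, hle i]
  have hinj : Function.Injective τ := by
    intro i j hij
    by_contra hne
    obtain ⟨r, hr1, hr2⟩ := exists_between (lt_min (hlt i) (hij ▸ hlt j))
    exact disjoint_left.1 (hdisj i j hne) ⟨hr1, hr2.trans_le (min_le_left _ _)⟩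
      ⟨hij ▸ hr1, hr2.trans_le (min_le_right _ _)⟩
  have hnext : ∀ i j, τ i < τ j → σ i ≤ τ j := by
    intro i j hij
    by_contra! hlt'
    obtain ⟨r, hr1, hr2⟩ := exists_between (lt_min hlt' (hlt j))
    exact disjoint_left.1 (hdisj i j fun h => hij.ne (h ▸ rfl))
      ⟨hij.trans hr1, hr2.trans_le (min_le_left _ _)⟩ ⟨hr1, hr2.trans_le (min_le_right _ _)⟩
  obtain ⟨n, e₀, hmono⟩ : ∃ (n : ℕ) (e₀ : Fin n ≃ ι), ∀ i j, i < j → τ (e₀ i) < τ (e₀ j) := by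
    let _ : LinearOrder ι := LinearOrder.lift' τ hinj
    exact ⟨_, (Fintype.orderIsoFinOfCardEq ι rfl).toEquiv,
      fun i j hij => (Fintype.orderIsoFinOfCardEq ι rfl).strictMono hij⟩
  have hn : 0 < n := by
    obtain ⟨x⟩ := ‹Nonempty ι›
    exact (Nat.zero_le _).trans_lt (e₀.symm x).2
  let e : ℕ → ι := fun i => if h : i < n then e₀ ⟨i, h⟩ else Classical.arbitrary ι
  have he : ∀ i (h : i < n), e i = e₀ ⟨i, h⟩ := fun i h => dif_pos h
  have hemono : ∀ i < n, ∀ j < n, i < j → τ (e i) < τ (e j) := by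
    intro i hi j hj hij
    rw [he i hi, he j hj]
    exact hmono _ _ hij
  have hsum : ∑ j ∈ Finset.range n, ℓ (e j) = ∑ i, ℓ i := by
    rw [Finset.sum_range, ← Equiv.sum_comp e₀]
    exact Finset.sum_congr rfl fun i _ => by rw [he i i.2]
  -- The gap accumulated before the `i`-th interval grows with `i` and is not positive at the end.
  have hgap : ∀ i j, i ≤ j → j < n → τ (e i) - ∑ k ∈ Finset.range i, ℓ (e k) ≤
      τ (e j) - ∑ k ∈ Finset.range j, ℓ (e k) := by
    intro i j hij
    induction j, hij using Nat.le_induction with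
    | base => exact fun _ => le_rfl
    | succ j hij ih =>
      intro hj
      refine (ih (by omega)).trans ?_
      rw [Finset.sum_range_succ]
      linarith [hnext _ _ (hemono j (by omega) (j + 1) hj (by omega)), hle (e j)]
  have hlast : τ (e (n - 1)) - ∑ k ∈ Finset.range (n - 1), ℓ (e k) ≤ 0 := by
    have h1 : ∑ k ∈ Finset.range (n - 1 + 1), ℓ (e k) = ∑ i, ℓ i := by
      rw [Nat.sub_add_cancel hn, hsum]
    rw [Finset.sum_range_succ] at h1
    linarith [hle (e (n - 1)), hσ (e (n - 1))]
  have hτe : ∀ i < n, τ (e i) = ∑ j ∈ Finset.range i, ℓ (e j) := by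
    intro i hi
    have h1 := hgap 0 i (Nat.zero_le _) hi
    have h2 := hgap i (n - 1) (by omega) (by omega)
    rw [Finset.sum_range_zero] at h1
    linarith [hτ (e 0)]
  have hMle : ∑ i, ℓ i ≤ M := by
    have h1 := hτe (n - 1) (by omega)
    have h2 : ∑ k ∈ Finset.range (n - 1 + 1), ℓ (e k) = ∑ i, ℓ i := by
      rw [Nat.sub_add_cancel hn, hsum]
    rw [Finset.sum_range_succ] at h2
    linarith [hle (e (n - 1)), hσ (e (n - 1))]
  refine ⟨n, e, hn, fun x => ⟨e₀.symm x, (e₀.symm x).2, by rw [he _ (e₀.symm x).2]; simp⟩, hemono,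
    hτe, fun i hi => le_antisymm ?_ (hle _), by rw [hsum]; linarith⟩
  rcases Nat.lt_or_ge (i + 1) n with h | h
  · have h1 := hnext _ _ (hemono i hi (i + 1) h (by omega))
    rw [hτe (i + 1) h, Finset.sum_range_succ, ← hτe i hi] at h1
    exact h1
  · have hin : i + 1 = n := by omega
    have h1 := hτe i hi
    have h2 : ∑ k ∈ Finset.range (i + 1), ℓ (e k) = ∑ i, ℓ i := by rw [hin, hsum]
    rw [Finset.sum_range_succ] at h2
    linarith [hσ (e i)]

/-- A tour that takes at most twice the total length has no time for anything but one traversal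
of each arc in each direction; the order rule of depth-first search holds because
the way back from a node begins with the last visit to it. -/
theorem IsTour.isDF [Nontrivial Q] [MeasurableSpace Q] [BorelSpace Q] (hQ : IsTreeNetwork Q)
    {O : Q} {S : Search O} {M : ℝ} (hS : IsTour O S.curve M) (hM : M ≤ 2 * totalLength Q) :
    IsDF S := by
  have harc : ∀ p : hQ.arcs O, IsArc O p.1.1 p.1.2 := fun p => hQ.mem_arcs.1 p.2
  choose τ σ hτ hσ hlen hτa hσb hin hdown hup using fun p : hQ.arcs O =>
    hS.exists_traversal hQ (harc p)
  have hτσ : ∀ p, τ p ≤ σ p := fun p => by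
    linarith [hlen p, dist_nonneg (x := p.1.1) (y := p.1.2)]
  have hne : Nonempty (hQ.arcs O) := by
    obtain ⟨z, hz⟩ := exists_ne O
    obtain ⟨a, b, hab, -⟩ := hQ.exists_isArc_mem_path hz
    exact ⟨⟨(a, b), hQ.mem_arcs.2 hab⟩⟩
  have hswap : ∀ p q : hQ.arcs O, q.1 = p.1.swap → p.1.1 ∈ path O p.1.2 → σ p ≤ τ q := by
    intro p q hpq hp
    refine hdown p hp (τ q) ⟨hτ q, (hτσ q).trans (hσ q)⟩ ?_
    rw [hτa q, hpq, Prod.fst_swap]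
  have hdisj : ∀ p q : hQ.arcs O, p ≠ q → Disjoint (Ioo (τ p) (σ p)) (Ioo (τ q) (σ q)) := by
    intro p q hpq
    refine disjoint_left.2 fun t htp htq => ?_
    obtain ⟨hp1, hp2, hp3⟩ := hin p t htp
    obtain ⟨hq1, hq2, hq3⟩ := hin q t htq
    rcases hQ.eq_or_eq_swap (harc p) (harc q) hp1 hq1 hp2 hp3 hq2 hq3 with h | h
    · exact hpq (Subtype.ext h).symm
    · rcases hQ.mem_path_root (harc p) with hp | hp
      · linarith [hswap p q h hp, htp.2, htq.1]
      · have h' : p.1 = q.1.swap := by rw [h, Prod.swap_swap]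
        have hq : q.1.1 ∈ path O q.1.2 := by rwa [h, Prod.fst_swap, Prod.snd_swap]
        linarith [hswap q p h' hq, htq.2, htp.1]
  obtain ⟨n, e, hn, hsurj, hmono, hτe, hσe, hMe⟩ := exists_enumeration (τ := τ) (σ := σ) (M := M)
    (ℓ := fun p => dist p.1.1 p.1.2) (fun p => dist_pos.2 (harc p).2.2.1) hτ hσ hlen hdisj
    (by rwa [Finset.sum_coe_sort (hQ.arcs O) fun p => dist p.1 p.2, hQ.sum_arcs O])
  let v : ℕ → Q := fun i => if i < n then (e i).1.1 else O
  have hv : ∀ i < n, v i = (e i).1.1 := fun i hi => if_pos hi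
  have hvn : v n = O := if_neg (lt_irrefl n)
  have hv' : ∀ i < n, v (i + 1) = (e i).1.2 := by
    intro i hi
    have h1 : σ (e i) = ∑ j ∈ Finset.range (i + 1), dist (e j).1.1 (e j).1.2 := by
      rw [Finset.sum_range_succ, hσe i hi, hτe i hi]
    rw [← hσb (e i), h1]
    rcases Nat.lt_or_ge (i + 1) n with h | h
    · rw [← hτe (i + 1) h, hτa, hv _ h]
    · obtain rfl : i + 1 = n := by omega
      rw [← hMe, hS.finish, hvn]
  have harr : ∀ i ≤ n, arrivalTime v i = ∑ j ∈ Finset.range i, dist (e j).1.1 (e j).1.2 := by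
    intro i hi
    refine Finset.sum_congr rfl fun j hj => ?_
    have hjn : j < n := (Finset.mem_range.1 hj).trans_le hi
    rw [hv j hjn, hv' j hjn]
  refine ⟨n, v, ?_, hvn, ?_, ?_, ?_, ?_⟩
  · have h0 := hτe 0 hn
    rw [Finset.sum_range_zero] at h0
    rw [hv 0 hn, ← hτa (e 0), h0, hS.start]
  · intro i hi
    rw [hv i hi, hv' i hi]
    exact harc (e i)
  · intro a b hab
    obtain ⟨i, hi, hei⟩ := hsurj ⟨(a, b), hQ.mem_arcs.2 hab⟩
    refine ⟨i, ⟨hi, by rw [hv i hi, hei], by rw [hv' i hi, hei]⟩, ?_⟩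
    rintro j ⟨hj, h1, h2⟩
    have hej : e j = e i := by
      rw [hv j hj] at h1
      rw [hv' j hj] at h2
      rw [hei]
      exact Subtype.ext (Prod.ext h1 h2)
    rcases lt_trichotomy i j with h | h | h
    · exact absurd (hmono i hi j hj h) (by rw [hej]; exact lt_irrefl _)
    · exact h.symm
    · exact absurd (hmono j hj i hi h) (by rw [hej]; exact lt_irrefl _)
  · intro i hi hback w hw hwne
    rw [hv i hi, hv' i hi] at hback
    obtain ⟨j, hj, hej⟩ := hsurj ⟨(v i, w), hQ.mem_arcs.2 hw⟩
    have hvj : v j = v i := by rw [hv j hj, hej]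
    have hvj' : v (j + 1) = w := by rw [hv' j hj, hej]
    refine ⟨j, ?_, hvj, hvj'⟩
    have hle : τ (e j) ≤ τ (e i) := by
      refine hup (e i) hback _ ⟨hτ _, (hτσ _).trans (hσ _)⟩ ?_
      rw [hτa, ← hv j hj, ← hv i hi, hvj]
    rcases lt_trichotomy i j with h | h | h
    · exact absurd (hmono i hi j hj h) (not_lt.2 hle)
    · exact absurd (h ▸ hvj').symm hwne
    · exact h
  · intro i hi t h1 h2
    rw [harr i hi.le, ← hτe i hi] at h1
    rw [harr (i + 1) hi, Finset.sum_range_succ, ← hτe i hi, ← hσe i hi] at h2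
    rw [harr i hi.le, ← hτe i hi, hv i hi, hv' i hi, ← S.curve_coe]
    have d1 := S.lipschitzWith_curve.dist_le_mul (τ (e i)) t
    have d2 := S.lipschitzWith_curve.dist_le_mul t (σ (e i))
    rw [Real.dist_eq, abs_of_nonpos (by linarith), hτa, NNReal.coe_one] at d1
    rw [Real.dist_eq, abs_of_nonpos (by linarith), hσb, NNReal.coe_one] at d2
    have d3 := dist_triangle (e i).1.1 (S.curve t) (e i).1.2
    have d4 := hσe i hi
    exact ⟨mem_path.2 (by linarith), by linarith⟩

theorem IsTour.ofCurve {O : Q} {f : ℝ → Q} {M : ℝ} (h : IsTour O f M) :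
    IsTour O (Search.ofCurve f h.lipschitz h.start).curve M where
  lipschitz := Search.lipschitzWith_curve _
  nonneg := h.nonneg
  start := Search.curve_zero _
  finish := by rw [Search.curve_ofCurve _ _ h.nonneg, h.finish]
  cover := by rw [Search.image_curve_ofCurve, h.cover]

theorem meanDist_nonneg [MeasurableSpace Q] (ν : Measure Q) (x : Q) : 0 ≤ meanDist ν x :=
  integral_nonneg fun _ => dist_nonneg

/-! ### Optimal searches -/

variable [MeasurableSpace Q] [BorelSpace Q] [Nontrivial Q]

theorem IsTreeNetwork.exists_isDF (hQ : IsTreeNetwork Q) (O : Q) : ∃ S : Search O, IsDF S := by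
  obtain ⟨f, M, hf, hM⟩ := hQ.exists_isTour O
  exact ⟨_, hf.ofCurve.isDF hQ hM⟩

theorem IsDF.expectedTime_add_meanDist (hQ : IsTreeNetwork Q) {O : Q} {S : Search O}
    (hS : IsDF S) : expectedTime S (uniform Q) + ENNReal.ofReal (meanDist (uniform Q) O) =
      ENNReal.ofReal (totalLength Q) := by
  obtain ⟨M, hM, hT⟩ := hS.exists_isTour hQ
  exact hQ.expectedTime_of_tour S hT.nonneg hM hT.finish hT.cover

theorem IsDF.expectedTime_ne_top (hQ : IsTreeNetwork Q) {O : Q} {S : Search O} (hS : IsDF S) :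
    expectedTime S (uniform Q) ≠ ⊤ := fun h => by
  have := hS.expectedTime_add_meanDist hQ
  rw [h, top_add] at this
  exact ENNReal.ofReal_ne_top this.symm

theorem IsDF.toReal_expectedTime (hQ : IsTreeNetwork Q) {O : Q} {S : Search O} (hS : IsDF S) :
    (expectedTime S (uniform Q)).toReal = totalLength Q - meanDist (uniform Q) O := by
  have h := congrArg ENNReal.toReal (hS.expectedTime_add_meanDist hQ)
  rw [ENNReal.toReal_add (hS.expectedTime_ne_top hQ) ENNReal.ofReal_ne_top,
    ENNReal.toReal_ofReal (meanDist_nonneg _ _), ENNReal.toReal_ofReal hQ.totalLength_pos.le] at h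
  linarith

theorem IsDF.isOptimal (hQ : IsTreeNetwork Q) {O : Q} {S : Search O} (hS : IsDF S) :
    IsOptimal S (uniform Q) := fun S' =>
  (ENNReal.add_le_add_iff_right ENNReal.ofReal_ne_top).1
    ((hS.expectedTime_add_meanDist hQ).trans_le (hQ.totalLength_le S'))

theorem IsOptimal.isDFUntilCovered (hQ : IsTreeNetwork Q) {O : Q} {S : Search O}
    (hS : IsOptimal S (uniform Q)) : IsDFUntilCovered S := by
  obtain ⟨S₀, hS₀⟩ := hQ.exists_isDF O
  obtain ⟨M, hM0, hcov, hM⟩ := hQ.exists_cover_time S (by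
    rw [← hS₀.expectedTime_add_meanDist hQ]
    gcongr
    exact hS S₀)
  obtain ⟨g, hg, hgS⟩ := hQ.exists_isTour_of_cover S.lipschitzWith_curve S.curve_zero hM0 hcov
  refine ⟨_, hg.ofCurve.isDF hQ hM, fun t ht => ?_⟩
  have htM : (t : ℝ) ≤ M := by
    by_contra! hlt
    refine ht (eq_univ_of_univ_subset ?_)
    rw [← hcov, ← S.image_curve]
    exact image_mono (Icc_subset_Icc_right hlt.le)
  change S.toFun t = g t
  rw [hgS t htM, S.curve_coe]

/-! ### Roots with the largest mean distance -/

theorem IsTreeNetwork.continuous_meanDist (hQ : IsTreeNetwork Q) :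
    Continuous (meanDist (uniform Q)) := by
  have := hQ.compactSpace
  have := hQ.isFiniteMeasure_uniform
  refine continuous_of_dominated (bound := fun _ => Metric.diam (univ : Set Q))
    (fun x => (hQ.integrable_dist x).aestronglyMeasurable) (fun x => ?_) (integrable_const _)
    (.of_forall fun y => by fun_prop)
  refine .of_forall fun y => ?_
  rw [Real.norm_of_nonneg dist_nonneg]
  exact Metric.dist_le_diam_of_mem isCompact_univ.isBounded (mem_univ _) (mem_univ _)

/-- A point `x` that is not a leaf is the midpoint of some path, and at the midpoint of a path the
mean distance is smaller than the average of its values at the two ends. -/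
theorem IsTreeNetwork.exists_meanDist_lt (hQ : IsTreeNetwork Q) {x : Q} (hx : ¬ IsLeaf x) :
    ∃ y, meanDist (uniform Q) x < meanDist (uniform Q) y := by
  rw [hQ.isLeaf_iff] at hx
  push Not at hx
  obtain ⟨p, q, hp, hq, hpq⟩ := hx
  obtain ⟨y, hy, hyd⟩ := hQ.exists_mem_path_dist_eq x p (r := min (dist x p) (dist x q))
    (by positivity) (min_le_left _ _)
  obtain ⟨z, hz, hzd⟩ := hQ.exists_mem_path_dist_eq x q (r := min (dist x p) (dist x q))
    (by positivity) (min_le_right _ _)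
  set ε := min (dist x p) (dist x q)
  have hε : 0 < ε := lt_min (dist_pos.2 hp.symm) (dist_pos.2 hq.symm)
  have hxyz : x ∈ path y z :=
    mem_path_shift' (mem_path_shift hpq (path_comm x p ▸ hy)) hz
  let g : Q → ℝ := fun w => dist y w + dist z w - 2 * dist x w
  have hg : Continuous g := by fun_prop
  have hg0 : 0 ≤ g := by
    intro w
    change 0 ≤ dist y w + dist z w - 2 * dist x w
    rcases hQ.path_subset_union y w z hxyz with h | h
    · have h1 := mem_path.1 h
      rw [dist_comm y x] at h1
      linarith [dist_triangle x z w]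
    · have h1 := mem_path.1 h
      rw [dist_comm w x, dist_comm w z] at h1
      linarith [dist_triangle x y w]
  have hi := hQ.integrable_dist
  have hint : Integrable g (uniform Q) := ((hi y).add (hi z)).sub ((hi x).const_mul 2)
  have hsum : ∫ w, g w ∂uniform Q =
      meanDist (uniform Q) y + meanDist (uniform Q) z - 2 * meanDist (uniform Q) x := by
    change ∫ w, (dist y w + dist z w - 2 * dist x w) ∂uniform Q = _
    have hadd : Integrable (fun w => dist y w + dist z w) (uniform Q) := (hi y).add (hi z)
    rw [integral_sub hadd ((hi x).const_mul 2), integral_add (hi y) (hi z),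
      integral_const_mul]
    rfl
  have hpos : 0 < ∫ w, g w ∂uniform Q := by
    rw [integral_pos_iff_support_of_nonneg hg0 hint]
    have hx : x ∈ g ⁻¹' Ioi 0 := by
      change 0 < dist y x + dist z x - 2 * dist x x
      rw [dist_comm y, dist_comm z, hyd, hzd, dist_self]
      linarith
    have hlen := hQ.lengthMeasure_pos (isOpen_Ioi.preimage hg) ⟨x, hx⟩
    have := hQ.isFiniteMeasure
    have hsub : g ⁻¹' Ioi 0 ⊆ Function.support g := fun w hw => (mem_Ioi.1 hw).ne'
    refine lt_of_lt_of_le ?_ (measure_mono hsub)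
    rw [uniform, Measure.smul_apply, smul_eq_mul]
    exact ENNReal.mul_pos (ENNReal.inv_ne_zero.2 (measure_ne_top _ _)) hlen.ne'
  by_contra! hc
  linarith [hc y, hc z]

/-- Every mean distance is bounded by that of some leaf. -/
theorem IsTreeNetwork.exists_isLeaf_meanDist_max (hQ : IsTreeNetwork Q) :
    ∃ l : Q, IsLeaf l ∧ ∀ y, meanDist (uniform Q) y ≤ meanDist (uniform Q) l := by
  have := hQ.compactSpace
  obtain ⟨l, -, hl⟩ := isCompact_univ.exists_isMaxOn univ_nonempty
    hQ.continuous_meanDist.continuousOn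
  refine ⟨l, ?_, fun y => hl (mem_univ y)⟩
  by_contra h
  obtain ⟨y, hy⟩ := hQ.exists_meanDist_lt h
  exact absurd (hl (mem_univ y)) (not_le.2 hy)

theorem IsTreeNetwork.expectedTime_le_iff (hQ : IsTreeNetwork Q) (x y : Q) :
    (∀ (S : Search x) (S' : Search y), IsDF S → IsDF S' →
      expectedTime S (uniform Q) ≤ expectedTime S' (uniform Q)) ↔
      meanDist (uniform Q) y ≤ meanDist (uniform Q) x := by
  have key : ∀ (S : Search x) (S' : Search y), IsDF S → IsDF S' →
      (expectedTime S (uniform Q) ≤ expectedTime S' (uniform Q) ↔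
        meanDist (uniform Q) y ≤ meanDist (uniform Q) x) := by
    intro S S' hS hS'
    rw [← ENNReal.toReal_le_toReal (hS.expectedTime_ne_top hQ) (hS'.expectedTime_ne_top hQ),
      hS.toReal_expectedTime hQ, hS'.toReal_expectedTime hQ, sub_le_sub_iff_left]
  constructor
  · intro h
    obtain ⟨S, hS⟩ := hQ.exists_isDF x
    obtain ⟨S', hS'⟩ := hQ.exists_isDF y
    exact (key S S' hS hS').1 (h S S' hS hS')
  · exact fun h S S' hS hS' => (key S S' hS hS').2 h

end TreeSearch

open TreeSearch
theorem mainTheorem6 {Q : Type*} [MetricSpace Q] [MeasurableSpace Q] [BorelSpace Q]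
    [Nontrivial Q] (hQ : IsTreeNetwork Q) :
    (∀ O : Q, StronglySimplySearchable O (uniform Q) ∧
      value O (uniform Q) ≠ ⊤ ∧
      (value O (uniform Q)).toReal = totalLength Q - meanDist (uniform Q) O) ∧
    (∃ x : Q, IsLeaf x ∧
      ∀ y : Q, IsLeaf y → meanDist (uniform Q) y ≤ meanDist (uniform Q) x) ∧
    (∀ x : Q,
      (∀ (y : Q) (S : Search x) (S' : Search y), IsDF S → IsDF S' →
        expectedTime S (uniform Q) ≤ expectedTime S' (uniform Q)) ↔
      (IsLeaf x ∧ ∀ y : Q, IsLeaf y → meanDist (uniform Q) y ≤ meanDist (uniform Q) x)) := by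
  obtain ⟨l, hl, hmax⟩ := hQ.exists_isLeaf_meanDist_max
  refine ⟨fun O => ?_, ⟨l, hl, fun y _ => hmax y⟩, fun x => ?_⟩
  · obtain ⟨S, hS⟩ := hQ.exists_isDF O
    have hval : value O (uniform Q) = expectedTime S (uniform Q) :=
      le_antisymm (iInf_le _ S) (le_iInf (hS.isOptimal hQ))
    rw [hval]
    exact ⟨⟨⟨S, hS.isOptimal hQ⟩, fun _ h => h.isDFUntilCovered hQ⟩, hS.expectedTime_ne_top hQ,
      hS.toReal_expectedTime hQ⟩
  · rw [forall_congr' (hQ.expectedTime_le_iff x)]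
    constructor
    · refine fun h => ⟨?_, fun y _ => h y⟩
      by_contra hx
      obtain ⟨y, hy⟩ := hQ.exists_meanDist_lt hx
      exact absurd (h y) (not_le.2 hy)
    · exact fun h y => (hmax y).trans (h.2 l hl)
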